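/- Let $H,K$ be real Hilbert spaces and let $T\colon H\to K$ be a Hilbert–Schmidt operator, i.e. $\operatorname{tr}(T^*T)<\infty$. For $f\in H$ one observes $Y=Tf+\sigma\xi$, where $\sigma>0$ and $\xi$ is a Gaussian white noise in $K$: a weak random element, i.e. $k\mapsto\langle\xi,k\rangle$ is almost surely linear and $\langle\xi,k\rangle\sim N(0,\|k\|^2)$ for all $k\in K$. Write $P_f$ for the law when the signal is $f$. Put $a:=\|T^*T\|$, and define functions $h(T^*T)$ by the spectral decomposition of the compact self-adjoint operator $T^*T$. *Regularization.* Let $(g_\tau)_{\tau>0}$ be a linear regularization: real functions on $[0,a]$ such that, with $r_\tau(t):=1-t\,g_\tau(t)$, 1. for each $0<t\le a$ the map $\tau\mapsto g_\tau(t)$ is piecewise continuous on $(0,a]$, and $|r_\tau(t)|\to0$ as $\tau\to0$; 2. $\sup_{0\le t\le a}|r_\tau(t)|\le\gamma_1$ for all $0<\tau\le a$; 3. $\sup_{0<t\le a}\tau|g_\tau(t)|\le\gamma_0$ for all $\tau>0$, where $\gamma_0\ge1$. Let $R_\tau:=g_\tau(T^*T)T^*$ and $f_\tau:=R_\tau Tf$.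 Let $\varphi$ be an index function, i.e. $\varphi\colon[0,\infty)\to\mathbb R$ is continuous and non-decreasing with $\varphi(0)=0$, and suppose that $(g_\tau)$ has qualification $\varphi$ with constant $\gamma$: $\sup_{0\le t\le a}|r_\tau(t)|\varphi(t)\le\gamma\varphi(\tau)$ for all $\tau>0$. Let $\mathcal E_\varphi:=\{\varphi(T^*T)w:\|w\|\le1\}$, and let $\mathcal N(\tau):=\operatorname{tr}\big((T^*T+\tau I)^{-1}T^*T\big)$ be the effective dimension. *Test.* Let $\alpha,\beta\in(0,1)$, $x_\alpha:=\log(1/\alpha)$, $x_\beta:=\log(1/\beta)$ and $C^*_{\alpha,\beta}:=4\sqrt{x_\beta}+4\sqrt{2x_\alpha}$. For $\tau>0$ put $S_\tau^2:=\sigma^2\operatorname{tr}(R_\tau^*R_\tau)$, $v_\tau^2:=\sigma^2\|R_\tau\|^2$ and $$r^2(\tau):=C^*_{\alpha,\beta}S_\tau v_\tau+(4x_\alpha+8x_\beta)v_\tau^2 .$$ Let $\Phi_{\alpha,\tau}:=\mathbf 1\{\|R_\tau Y\|^2-S_\tau^2>t_{\tau,\alpha}\}$, where $t_{\tau,\alpha}$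 is the $(1-\alpha)$-quantile of $\|R_\tau Y\|^2-S_\tau^2$ under $f=0$. Its separation radius is $$\rho(\Phi,\beta,\mathcal E):=\inf\Big\{\rho\ge0:\ \sup_{f\in\mathcal E,\ \|f\|>\rho}P_f(\Phi=0)\le\beta\Big\}.$$ *Theorem.* Let $\tau_*>0$ satisfy $\varphi^2(\tau_*)=\sigma^2\sqrt{\mathcal N(\tau_*)}/\tau_*$. Let $\gamma_*\ge1$ be any constant with $\tau|g_\tau(t)|\le\gamma_*$ and $t|g_\tau(t)|\le\gamma_*$ for all $\tau>0$ and $0<t\le a$; the number $\max(\gamma_0,1+\gamma_1)$ always is such a constant. Then for every $f\in\mathcal E_\varphi$ $$\inf_{\tau>0}\big(r^2(\tau)+\|f-f_\tau\|^2\big)\le\Big(C^*_{\alpha,\beta}\sqrt2\,\gamma_*^2+\frac{(4x_\alpha+8x_\beta)\gamma_*^2}{\sqrt{\mathcal N(\tau_*)}}+\gamma^2\Big)\varphi^2(\tau_*),$$ and $$\rho^2(\Phi_{\alpha,\tau_*},\beta,\mathcal E_\varphi)\le2\Big(C^*_{\alpha,\beta}\sqrt2\,\gamma_*^2+\frac{(4x_\alpha+8x_\beta)\gamma_*^2}{\sqrt{\mathcal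 N(\tau_*)}}+\gamma^2\Big)\varphi^2(\tau_*).$$ (If $T=0$, the fraction is read as $0$.) -/

import Mathlib

open MeasureTheory ProbabilityTheory Filter Topology Set
open scoped ENNReal NNReal InnerProductSpace

noncomputable section

namespace InverseTesting

variable {H K : Type*} [NormedAddCommGroup H] [InnerProductSpace ℝ H] [CompleteSpace H]
  [NormedAddCommGroup K] [InnerProductSpace ℝ K] [CompleteSpace K]
variable {Ω : Type*} [MeasurableSpace Ω]

/-! ### Operators in Hilbert space -/

/-- The index set of a Hilbert basis of `H`. -/
def basisIndex (H : Type*) [NormedAddCommGroup H] [InnerProductSpace ℝ H] [CompleteSpace H] :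
    Set H :=
  Classical.choose (exists_hilbertBasis ℝ H)

/-- A Hilbert basis (complete orthonormal system) of `H`. -/
def basis (H : Type*) [NormedAddCommGroup H] [InnerProductSpace ℝ H] [CompleteSpace H] :
    HilbertBasis (basisIndex H) ℝ H :=
  Classical.choose (Classical.choose_spec (exists_hilbertBasis ℝ H))

/-- The trace `∑ i, ⟪B eᵢ, eᵢ⟫ ∈ [0, ∞]` of a positive operator `B`
(it does not depend on the Hilbert basis). -/
def posTrace (B : H →L[ℝ] H) : ℝ≥0∞ :=
  ∑' i, ENNReal.ofReal ⟪B (basis H i), basis H i⟫_ℝ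

/-- The self-adjoint companion `T* T` of `T`. -/
def companion (T : H →L[ℝ] K) : H →L[ℝ] H :=
  (ContinuousLinearMap.adjoint T) ∘L T

/-- `T` is a Hilbert–Schmidt operator: `tr (T* T) < ∞`. -/
def IsHilbertSchmidt (T : H →L[ℝ] K) : Prop :=
  posTrace (companion T) < ∞

open Classical in
/-- The operator function `h(A)` of a compact self-adjoint operator `A`, where `h` is a real
function which is bounded on the set of eigenvalues of `A`: the bounded operator that acts as
multiplication by `h μ` on `ker (A - μ)`, for every real `μ`. As the eigenspaces of `A` span a
dense subspace, there is exactly one such operator. -/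
def opFun (A : H →L[ℝ] H) (h : ℝ → ℝ) : H →L[ℝ] H :=
  if hB : ∃ B : H →L[ℝ] H, ∀ (μ : ℝ) (x : H), A x = μ • x → B x = h μ • x then
    Classical.choose hB
  else 0

open Ring in
/-- The effective dimension `𝒩(l) = tr ((T* T + l I)⁻¹ T* T)`. -/
def effectiveDim (T : H →L[ℝ] K) (l : ℝ) : ℝ :=
  (posTrace ((companion T + l • ContinuousLinearMap.id ℝ H)⁻¹ʳ * companion T)).toReal

/-! ### Linear regularization, index functions, qualification and source sets -/

/-- `u` is piecewise continuous on `(0, a]`: in every `[b, a]` with `b > 0` it has only finitely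
many discontinuities, and it has finite one-sided limits. -/
def PiecewiseContinuous (a : ℝ) (u : ℝ → ℝ) : Prop :=
  (∀ b > 0, {τ ∈ Icc b a | ¬ ContinuousWithinAt u (Ioc 0 a) τ}.Finite) ∧
  (∀ τ ∈ Ioc 0 a, ∃ l, Tendsto u (𝓝[<] τ) (𝓝 l)) ∧
  (∀ τ ∈ Ioo 0 a, ∃ l, Tendsto u (𝓝[>] τ) (𝓝 l))

/-- The residual function `r_τ(t) = 1 - t g_τ(t)`. -/
def residualFn (g : ℝ → ℝ → ℝ) (τ t : ℝ) : ℝ := 1 - t * g τ t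

/-- The family `g τ`, `τ > 0`, of functions on `(0, a]`, where `a = ‖T* T‖`, is a linear
regularization with constants `γ₁` and `γ₀`. (The value `g τ 0` plays no role.) -/
structure IsRegularization (a : ℝ) (g : ℝ → ℝ → ℝ) (γ₁ γ₀ : ℝ) : Prop where
  piecewise : ∀ t ∈ Ioc 0 a, PiecewiseContinuous a (fun τ => g τ t)
  convergence : ∀ t ∈ Ioc 0 a, Tendsto (fun τ => |residualFn g τ t|) (𝓝[>] 0) (𝓝 0)
  residual_le : ∀ τ ∈ Ioc 0 a, ∀ t ∈ Icc 0 a, |residualFn g τ t| ≤ γ₁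
  one_le : 1 ≤ γ₀
  growth_le : ∀ τ > 0, ∀ t ∈ Ioc 0 a, τ * |g τ t| ≤ γ₀

/-- `γs ≥ 1` bounds both `τ |g_τ(t)|` and `t |g_τ(t)|`, for `τ > 0` and `0 < t ≤ a`. -/
structure IsGrowthConstant (a : ℝ) (g : ℝ → ℝ → ℝ) (γs : ℝ) : Prop where
  one_le : 1 ≤ γs
  param_le : ∀ τ > 0, ∀ t ∈ Ioc 0 a, τ * |g τ t| ≤ γs
  arg_le : ∀ τ > 0, ∀ t ∈ Ioc 0 a, t * |g τ t| ≤ γs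

/-- Index functions: continuous, non-decreasing on `[0, ∞)`, and vanishing at `0`. -/
structure IsIndexFunction (φ : ℝ → ℝ) : Prop where
  continuousOn : ContinuousOn φ (Ici 0)
  monotoneOn : MonotoneOn φ (Ici 0)
  map_zero : φ 0 = 0

/-- The regularization `g` has qualification `φ` with constant `γ`. -/
def HasQualification (a : ℝ) (g : ℝ → ℝ → ℝ) (φ : ℝ → ℝ) (γ : ℝ) : Prop :=
  ∀ τ > 0, ∀ t ∈ Icc 0 a, |residualFn g τ t| * φ t ≤ γ * φ τ

/-- The source set `ℰ_φ = {φ(T* T) w : ‖w‖ ≤ 1}`. -/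
def sourceSet (T : H →L[ℝ] K) (φ : ℝ → ℝ) : Set H :=
  {f | ∃ w : H, ‖w‖ ≤ 1 ∧ f = opFun (companion T) φ w}

/-- The reconstruction `R_τ = g_τ(T* T) T*`. -/
def reconstruction (T : H →L[ℝ] K) (g : ℝ → ℝ → ℝ) (τ : ℝ) : K →L[ℝ] H :=
  opFun (companion T) (g τ) ∘L ContinuousLinearMap.adjoint T

/-! ### The statistical model -/

/-- `ξ` is a Gaussian white noise in `K`: a weak random element of `K`, `⟪ξ, k⟫` being the random
variable `ξ k`, which is (almost surely) linear in `k`, with `⟪ξ, k⟫ ∼ N(0, ‖k‖²)`. -/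
structure IsWhiteNoise (ξ : K → Ω → ℝ) (P : Measure Ω) : Prop where
  add : ∀ k l : K, ξ (k + l) =ᵐ[P] ξ k + ξ l
  smul : ∀ (c : ℝ) (k : K), ξ (c • k) =ᵐ[P] c • ξ k
  hasLaw : ∀ k : K, HasLaw (ξ k) (gaussianReal 0 (‖k‖₊ ^ 2)) P

/-- The observation `Y = T f + σ ξ`, that is, `⟪Y, k⟫ = ⟪T f, k⟫ + σ ⟪ξ, k⟫` for `k` in `K`. -/
def observation (T : H →L[ℝ] K) (σ : ℝ) (ξ : K → Ω → ℝ) (f : H) : K → Ω → ℝ :=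
  fun k ω => ⟪T f, k⟫_ℝ + σ * ξ k ω

open Classical in
/-- The random element `R Y` of `H`, for a weak random element `Y` of `K`: the (almost surely
unique) strongly measurable `X : Ω → H` with `⟪X, w⟫ = ⟪Y, R* w⟫` almost surely, for all `w`.
It exists if `Y` is an observation and `R` is Hilbert–Schmidt. -/
def applyTo (R : K →L[ℝ] H) (Y : K → Ω → ℝ) (P : Measure Ω) : Ω → H :=
  if hX : ∃ X : Ω → H, StronglyMeasurable X ∧
      ∀ w : H, (fun ω => ⟪X ω, w⟫_ℝ) =ᵐ[P] Y (ContinuousLinearMap.adjoint R w) then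
    Classical.choose hX
  else 0

/-- The variance `S_R² = σ² tr (R* R)`. -/
def strongVar (σ : ℝ) (R : K →L[ℝ] H) : ℝ := σ ^ 2 * (posTrace (companion R)).toReal

/-- The weak variance `v_R² = σ² ‖R‖²`. -/
def weakVar (σ : ℝ) (R : K →L[ℝ] H) : ℝ := σ ^ 2 * ‖R‖ ^ 2

/-- The test statistic `‖R Y‖² - S_R²`. -/
def statistic (σ : ℝ) (R : K →L[ℝ] H) (P : Measure Ω) (Y : K → Ω → ℝ) (ω : Ω) : ℝ :=
  ‖applyTo R Y P ω‖ ^ 2 - strongVar σ R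

/-- The `1 - α` quantile of `‖R Y‖² - S_R²` under the null hypothesis `f = 0`. -/
def threshold (T : H →L[ℝ] K) (σ : ℝ) (ξ : K → Ω → ℝ) (P : Measure Ω) (α : ℝ)
    (R : K →L[ℝ] H) : ℝ :=
  sInf {t : ℝ | 1 - α ≤ P.real {ω | statistic σ R P (observation T σ ξ 0) ω ≤ t}}

open Classical in
/-- The test `Φ_{α,R}`, the indicator of `‖R Y‖² - S_R² > t_{R,α}`, when the signal is `f`. -/
def test (T : H →L[ℝ] K) (σ : ℝ) (ξ : K → Ω → ℝ) (P : Measure Ω) (α : ℝ)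
    (R : K →L[ℝ] H) (f : H) (ω : Ω) : ℕ :=
  if threshold T σ ξ P α R < statistic σ R P (observation T σ ξ f) ω then 1 else 0

/-- The separation radius
`ρ(Φ, β, E) = inf {ρ ≥ 0 : sup_{f ∈ E, ‖f‖ > ρ} P_f (Φ = 0) ≤ β}`, where `Φ f ω` is the value of
the test when the signal is `f`. -/
def separationRadius (P : Measure Ω) (Φ : H → Ω → ℕ) (β : ℝ) (E : Set H) : ℝ :=
  sInf {ρ : ℝ | 0 ≤ ρ ∧
    (⨆ f ∈ {f : H | f ∈ E ∧ ρ < ‖f‖}, P {ω | Φ f ω = 0}) ≤ ENNReal.ofReal β}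

/-- `x_α = log (1 / α)`. -/
def logLevel (α : ℝ) : ℝ := Real.log (1 / α)

/-- `C*_{α,β} = 4 √x_β + 4 √(2 x_α)`. -/
def Cstar (α β : ℝ) : ℝ := 4 * √(logLevel β) + 4 * √(2 * logLevel α)

/-- `r²(Φ_{α,R}, β) = C*_{α,β} S_R v_R + (4 x_α + 8 x_β) v_R²`. -/
def radiusSq (σ α β : ℝ) (R : K →L[ℝ] H) : ℝ :=
  Cstar α β * √(strongVar σ R) * √(weakVar σ R) +
    (4 * logLevel α + 8 * logLevel β) * weakVar σ R

end InverseTesting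

end

/-!
A Hilbert–Schmidt operator `T` is compact, so `H` has a Hilbert basis `b` of eigenvectors of `T*
T`, with eigenvalues `λ ≥ 0` (called `ev` below). In this basis every operator function is
diagonal, and all deterministic quantities are series: `tr (R* R) = ∑ λ g(λ)²`, `‖R‖² ≤ sup λ
g(λ)²`, `𝒩(τ) = ∑ λ / (λ + τ)`, and `f - R T f` has the coordinates `r(λ) φ(λ) ⟪b, w⟫`. The two
growth conditions give `λ g(λ)² ≤ (2 γ² / τ) λ / (λ + τ)` and `λ g(λ)² ≤ γ² / τ`, whence `S² ≤ 2 γ²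
σ² 𝒩 / τ` and `v² ≤ γ² σ² / τ`; at the balancing parameter this bounds the radius by a multiple of
`φ²` (`radiusSq_le`), while the qualification bounds the bias (`norm_sub_reconstruction_le`).

For the test, `R* bⱼ` is an orthogonal family in `K`, so the coordinates `⟪Y, R* bⱼ⟫` of `R Y` are
independent Gaussian variables (`IsWhiteNoise.iIndepFun`), and `‖R Y‖²` is almost surely the sum of
their squares (`ae_hasSum_norm_sq_applyTo`; this includes the existence of `R Y`). Explicit
exponential moments of squared Gaussian variables and Chernoff's bound give an upper tail bound for
the central sum, which controls the threshold (`threshold_le`), and a lower tail bound for the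
non-central sum, which controls the error of the second kind as soon as `‖R T f‖²` exceeds the
radius (`measure_test_eq_zero_le`). Finally `‖f‖² ≤ 2 ‖R T f‖² + 2 ‖f - R T f‖²` yields the bound of
the separation radius (`separationRadius_sq_le`).
-/

namespace InverseTesting

section Operators

universe u

variable {H K I J : Type*} [NormedAddCommGroup H] [InnerProductSpace ℝ H] [CompleteSpace H]
  [NormedAddCommGroup K] [InnerProductSpace ℝ K] [CompleteSpace K]

/-! ### Hilbert bases and the trace -/

omit [CompleteSpace H] in
lemma hasSum_sq_inner (b : HilbertBasis J ℝ H) (x : H) :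
    HasSum (fun j => ⟪b j, x⟫_ℝ ^ 2) (‖x‖ ^ 2) := by
  have h := b.hasSum_inner_mul_inner x x
  rw [real_inner_self_eq_norm_sq] at h
  refine h.congr_fun fun j => ?_
  rw [real_inner_comm x (b j), sq]

omit [CompleteSpace H] in
lemma tsum_ofReal_sq_inner (b : HilbertBasis J ℝ H) (x : H) :
    ∑' j, ENNReal.ofReal (⟪b j, x⟫_ℝ ^ 2) = ENNReal.ofReal (‖x‖ ^ 2) := by
  rw [← (hasSum_sq_inner b x).tsum_eq, ENNReal.ofReal_tsum_of_nonneg (fun _ => sq_nonneg _)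
    (hasSum_sq_inner b x).summable]

/-- By Parseval and Tonelli; applied twice, it shows that the Hilbert–Schmidt norm does not
depend on the basis. -/
lemma tsum_norm_sq_eq_adjoint (b : HilbertBasis J ℝ H) (c : HilbertBasis I ℝ K) (B : H →L[ℝ] K) :
    ∑' j, ENNReal.ofReal (‖B (b j)‖ ^ 2) =
      ∑' i, ENNReal.ofReal (‖ContinuousLinearMap.adjoint B (c i)‖ ^ 2) := by
  simp_rw [← tsum_ofReal_sq_inner b, ← tsum_ofReal_sq_inner c]
  rw [ENNReal.tsum_comm]
  refine tsum_congr fun i => tsum_congr fun j => ?_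
  rw [ContinuousLinearMap.adjoint_inner_right, real_inner_comm]

lemma posTrace_companion_eq (b : HilbertBasis J ℝ H) (B : H →L[ℝ] K) :
    posTrace (companion B) = ∑' j, ENNReal.ofReal (‖B (b j)‖ ^ 2) := by
  rw [tsum_norm_sq_eq_adjoint b (basis K), ← tsum_norm_sq_eq_adjoint (basis H)]
  refine tsum_congr fun i => ?_
  rw [companion, ContinuousLinearMap.comp_apply, ContinuousLinearMap.adjoint_inner_left,
    real_inner_self_eq_norm_sq]

lemma posTrace_companion_eq_adjoint (c : HilbertBasis I ℝ K) (B : H →L[ℝ] K) :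
    posTrace (companion B) =
      ∑' i, ENNReal.ofReal (‖ContinuousLinearMap.adjoint B (c i)‖ ^ 2) := by
  rw [posTrace_companion_eq (basis H), tsum_norm_sq_eq_adjoint (basis H) c]

omit [CompleteSpace H] in
lemma clm_ext_of_basis (b : HilbertBasis J ℝ H) {E : Type*} [NormedAddCommGroup E]
    [NormedSpace ℝ E] {B C : H →L[ℝ] E} (h : ∀ j, B (b j) = C (b j)) : B = C := by
  refine ContinuousLinearMap.ext_on (s := Set.range b) ?_ ?_
  · exact Submodule.dense_iff_topologicalClosure_eq_top.2 b.dense_span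
  · rintro _ ⟨j, rfl⟩
    exact h j

/-- The operator norm is at most the Hilbert–Schmidt norm. -/
lemma ofReal_opNorm_sq_le (B : H →L[ℝ] K) :
    ENNReal.ofReal (‖B‖ ^ 2) ≤ posTrace (companion B) := by
  by_cases hfin : posTrace (companion B) = ∞
  · simp [hfin]
  rw [← ENNReal.ofReal_toReal hfin]
  refine ENNReal.ofReal_le_ofReal ?_
  have h : ‖B‖ ≤ √(posTrace (companion B)).toReal := by
    refine B.opNorm_le_bound (Real.sqrt_nonneg _) fun x => ?_
    refine le_of_sq_le_sq ?_ (by positivity)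
    rw [mul_pow, Real.sq_sqrt ENNReal.toReal_nonneg, ← ENNReal.ofReal_le_ofReal_iff (by positivity),
      ENNReal.ofReal_mul ENNReal.toReal_nonneg, ENNReal.ofReal_toReal hfin,
      ← tsum_ofReal_sq_inner (basis K), posTrace_companion_eq_adjoint (basis K),
      ← ENNReal.tsum_mul_right]
    refine ENNReal.tsum_le_tsum fun i => ?_
    rw [← ENNReal.ofReal_mul (sq_nonneg _), ← mul_pow]
    refine ENNReal.ofReal_le_ofReal (sq_le_sq' ?_ ?_) <;>
      rw [← ContinuousLinearMap.adjoint_inner_left]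
    · exact neg_le_of_abs_le (abs_real_inner_le_norm _ _)
    · exact real_inner_le_norm _ _
  calc ‖B‖ ^ 2 ≤ √(posTrace (companion B)).toReal ^ 2 := by gcongr
    _ = _ := Real.sq_sqrt ENNReal.toReal_nonneg

/-! ### Diagonal operators -/

omit [CompleteSpace H] in
lemma exists_diagonal (b : HilbertBasis J ℝ H) (c : J → ℝ) (M : ℝ) (hM : ∀ j, |c j| ≤ M) :
    ∃ D : H →L[ℝ] H, ∀ j, D (b j) = c j • b j := by
  classical
  have hM' : ∀ j, c j ^ 2 ≤ M ^ 2 := fun j => sq_le_sq' (abs_le.1 (hM j)).1 (abs_le.1 (hM j)).2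
  have hle (x : H) (j : J) : (c j * ⟪b j, x⟫_ℝ) ^ 2 ≤ M ^ 2 * ⟪b j, x⟫_ℝ ^ 2 := by
    rw [mul_pow]
    exact mul_le_mul_of_nonneg_right (hM' j) (sq_nonneg _)
  have hmem (x : H) : Memℓp (fun j => c j * ⟪b j, x⟫_ℝ) 2 := by
    refine memℓp_gen ?_
    simp only [ENNReal.toReal_ofNat, Real.rpow_ofNat, Real.norm_eq_abs, sq_abs]
    exact Summable.of_nonneg_of_le (fun _ => sq_nonneg _) (hle x)
      ((hasSum_sq_inner b x).summable.mul_left _)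
  let D₀ : H →ₗ[ℝ] lp (fun _ : J => ℝ) 2 :=
    { toFun := fun x => ⟨fun j => c j * ⟪b j, x⟫_ℝ, hmem x⟩
      map_add' := fun x y => by
        ext j
        exact (congrArg (c j * ·) (inner_add_right _ _ _)).trans (mul_add _ _ _)
      map_smul' := fun r x => by
        ext j
        exact (congrArg (c j * ·) (real_inner_smul_right _ _ _)).trans (mul_left_comm _ _ _) }
  have hD₀ (x : H) : ‖D₀ x‖ ≤ |M| * ‖x‖ := by
    refine le_of_sq_le_sq ?_ (by positivity)
    rw [← real_inner_self_eq_norm_sq, lp.inner_eq_tsum, mul_pow, sq_abs,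
      ← ((hasSum_sq_inner b x).mul_left _).tsum_eq]
    refine Summable.tsum_le_tsum (fun j => ?_) (lp.summable_inner _ _)
      ((hasSum_sq_inner b x).summable.mul_left _)
    refine le_trans (le_of_eq ?_) (hle x j)
    exact (real_inner_self_eq_norm_sq _).trans (sq_abs _)
  refine ⟨(b.repr.symm.toContinuousLinearEquiv : lp (fun _ : J => ℝ) 2 →L[ℝ] H) ∘L
    D₀.mkContinuous |M| hD₀, fun j => ?_⟩
  apply b.repr.injective
  ext i
  rw [map_smul]
  simp [D₀, HilbertBasis.repr_apply_apply]
  by_cases h : i = j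
  · exact Or.inl (by rw [h])
  · have := b.orthonormal.2 h
    simp [this]

omit [CompleteSpace H] in
lemma inner_diagonal (b : HilbertBasis J ℝ H) {D : H →L[ℝ] H} {c : J → ℝ}
    (hD : ∀ j, D (b j) = c j • b j) (j : J) (x : H) : ⟪b j, D x⟫_ℝ = c j * ⟪b j, x⟫_ℝ := by
  have h : (innerSL ℝ (b j)) ∘L D = c j • innerSL ℝ (b j) := by
    refine clm_ext_of_basis b fun i => ?_
    by_cases hij : j = i
    · subst hij
      simp [hD]
    · have := b.orthonormal.2 hij
      simp [hD, this]
  simpa using DFunLike.congr_fun h x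

omit [CompleteSpace H] in
lemma hasSum_norm_sq_diagonal (b : HilbertBasis J ℝ H) {D : H →L[ℝ] H} {c : J → ℝ}
    (hD : ∀ j, D (b j) = c j • b j) (x : H) :
    HasSum (fun j => c j ^ 2 * ⟪b j, x⟫_ℝ ^ 2) (‖D x‖ ^ 2) := by
  refine (hasSum_sq_inner b (D x)).congr_fun fun j => ?_
  rw [inner_diagonal b hD, mul_pow]

omit [CompleteSpace H] in
lemma norm_diagonal_le (b : HilbertBasis J ℝ H) {D : H →L[ℝ] H} {c : J → ℝ}
    (hD : ∀ j, D (b j) = c j • b j) {M : ℝ} (hM0 : 0 ≤ M) (hM : ∀ j, |c j| ≤ M) (x : H) :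
    ‖D x‖ ≤ M * ‖x‖ := by
  refine le_of_sq_le_sq ?_ (by positivity)
  rw [mul_pow]
  refine hasSum_le (fun j => ?_) (hasSum_norm_sq_diagonal b hD x)
    ((hasSum_sq_inner b x).mul_left _)
  exact mul_le_mul_of_nonneg_right (sq_le_sq' (abs_le.1 (hM j)).1 (abs_le.1 (hM j)).2)
    (sq_nonneg _)

lemma adjoint_diagonal (b : HilbertBasis J ℝ H) {D : H →L[ℝ] H} {c : J → ℝ}
    (hD : ∀ j, D (b j) = c j • b j) : ContinuousLinearMap.adjoint D = D := by
  refine clm_ext_of_basis b fun j => ?_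
  refine ext_inner_left ℝ fun x => ?_
  rw [ContinuousLinearMap.adjoint_inner_right, hD, inner_smul_right, real_inner_comm,
    inner_diagonal b hD, real_inner_comm]

/-! ### The spectral decomposition of `T* T` -/

/-- A Hilbert–Schmidt operator is the limit, even in Hilbert–Schmidt norm, of operators that agree
with it on finitely many basis vectors and kill the other ones. -/
lemma isCompactOperator_of_isHilbertSchmidt {T : H →L[ℝ] K} (hT : IsHilbertSchmidt T) :
    IsCompactOperator T := by
  classical
  let b := basis H
  -- `F s` agrees with `T` on the basis vectors in `s` and kills the other ones.
  let F (s : Finset (basisIndex H)) : H →L[ℝ] K :=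
    ∑ i ∈ s, (innerSL ℝ (b i)).smulRight (T (b i))
  have hF (s : Finset (basisIndex H)) (j : basisIndex H) :
      F s (b j) = if j ∈ s then T (b j) else 0 := by
    simp only [F, _root_.sum_apply, ContinuousLinearMap.smulRight_apply,
      innerSL_apply_apply]
    have h (i : basisIndex H) : ⟪b i, b j⟫_ℝ • T (b i) = if i = j then T (b j) else 0 := by
      rw [orthonormal_iff_ite.1 b.orthonormal]
      split_ifs with hij
      · simp [hij]
      · simp
    simp [h]
  have hcomp (s : Finset (basisIndex H)) : IsCompactOperator (F s) := by
    simp only [F]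
    induction s using Finset.induction_on with
    | empty => simpa using! isCompactOperator_zero
    | insert i s hi ih =>
      rw [Finset.sum_insert hi]
      refine IsCompactOperator.add ?_ ih
      have h : IsCompactOperator (ContinuousLinearMap.toSpanSingleton ℝ (T (b i))) :=
        isCompactOperator_id.clm_comp _
      exact h.comp_clm (innerSL ℝ (b i))
  have htr (s : Finset (basisIndex H)) : posTrace (companion (T - F s)) =
      ∑' i : {i // i ∉ s}, ENNReal.ofReal (‖T (b i)‖ ^ 2) := by
    rw [posTrace_companion_eq b]
    refine Eq.trans ?_ (tsum_subtype {i | i ∉ s} fun i => ENNReal.ofReal (‖T (b i)‖ ^ 2)).symm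
    refine tsum_congr fun i => ?_
    by_cases hi : i ∈ s <;> simp [hF, hi]
  have hlim : Tendsto F atTop (𝓝 T) := by
    rw [IsHilbertSchmidt, posTrace_companion_eq b] at hT
    have h0 := ENNReal.tendsto_tsum_compl_atTop_zero hT.ne
    simp_rw [← htr] at h0
    have h1 : Tendsto (fun s => ENNReal.ofReal (‖T - F s‖ ^ 2)) atTop (𝓝 0) :=
      tendsto_of_tendsto_of_tendsto_of_le_of_le tendsto_const_nhds h0 (fun _ => zero_le)
        fun s => ofReal_opNorm_sq_le _
    have h2 : Tendsto (fun s => ‖T - F s‖ ^ 2) atTop (𝓝 0) := by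
      have := (ENNReal.tendsto_toReal ENNReal.zero_ne_top).comp h1
      refine (this.congr fun s => ?_)
      simp
    rw [tendsto_iff_norm_sub_tendsto_zero]
    have h3 := h2.sqrt
    simp only [Real.sqrt_zero, Real.sqrt_sq (norm_nonneg _)] at h3
    simpa [norm_sub_rev] using h3
  exact isCompactOperator_of_tendsto hlim (Eventually.of_forall hcomp)

/-- The spectral theorem for `T* T`, obtained by collecting Hilbert bases of the eigenspaces. -/
lemma exists_eigenbasis {H : Type u} [NormedAddCommGroup H] [InnerProductSpace ℝ H]
    [CompleteSpace H] {T : H →L[ℝ] K} (hT : IsHilbertSchmidt T) :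
    ∃ (J : Type u) (b : HilbertBasis J ℝ H) (ev : J → ℝ),
      ∀ j, companion T (b j) = ev j • b j := by
  set A := companion T with hA
  have hcomp : IsCompactOperator A :=
    (isCompactOperator_of_isHilbertSchmidt hT).clm_comp (ContinuousLinearMap.adjoint T)
  have hsymm : A.IsSymmetric := by
    intro x y
    simp [hA, companion, ContinuousLinearMap.adjoint_inner_left,
      ContinuousLinearMap.adjoint_inner_right]
  let V (μ : ℝ) : Submodule ℝ H := Module.End.eigenspace (A : Module.End ℝ H) μ
  have hV (μ : ℝ) (x : H) : x ∈ V μ ↔ A x = μ • x := Module.End.mem_eigenspace_iff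
  have hcl (μ : ℝ) : IsClosed (V μ : Set H) := by
    have : (V μ : Set H) = {x | A x = μ • x} := by
      ext x
      exact hV μ x
    rw [this]
    exact isClosed_eq A.continuous (continuous_const_smul μ)
  have (μ : ℝ) : CompleteSpace (V μ) := (hcl μ).completeSpace_coe
  let J := Σ μ : ℝ, basisIndex (V μ)
  let v : J → H := fun j => (basis (V j.1) j.2 : H)
  have hv : Orthonormal ℝ v :=
    hsymm.orthogonalFamily_eigenspaces.orthonormal_sigma_orthonormal
      (fun μ => (basis (V μ)).orthonormal)
  have hspan : (Submodule.span ℝ (Set.range v))ᗮ = ⊥ := by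
    rw [eq_bot_iff, ← ContinuousLinearMap.orthogonalComplement_iSup_eigenspaces_eq_bot hcomp hsymm]
    intro x hx
    rw [← Submodule.iInf_orthogonal, Submodule.mem_iInf]
    intro μ
    rw [Submodule.mem_orthogonal]
    intro y hy
    have h : (innerSL ℝ x) ∘L (V μ).subtypeL = 0 := by
      refine clm_ext_of_basis (basis (V μ)) fun i => ?_
      have := (Submodule.mem_orthogonal _ _).1 hx (v ⟨μ, i⟩)
        (Submodule.subset_span (Set.mem_range_self _))
      simpa [real_inner_comm] using this
    have := DFunLike.congr_fun h ⟨y, hy⟩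
    simpa [real_inner_comm] using this
  refine ⟨J, HilbertBasis.mkOfOrthogonalEqBot hv hspan, fun j => j.1, fun j => ?_⟩
  rw [HilbertBasis.coe_mkOfOrthogonalEqBot]
  exact (hV _ _).1 (basis (V j.1) j.2).2

omit [CompleteSpace H] in
/-- The diagonal operator with entries `h (ev j)` satisfies the condition that defines `opFun A h`,
as an eigenvector for `μ` has nonzero coordinates only where `ev j = μ`. -/
lemma opFun_basis {A : H →L[ℝ] H} (b : HilbertBasis J ℝ H) {ev : J → ℝ}
    (hb : ∀ j, A (b j) = ev j • b j) {h : ℝ → ℝ} {M : ℝ} (hM : ∀ j, |h (ev j)| ≤ M) (j : J) :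
    opFun A h (b j) = h (ev j) • b j := by
  have hex : ∃ B : H →L[ℝ] H, ∀ (μ : ℝ) (x : H), A x = μ • x → B x = h μ • x := by
    obtain ⟨D, hD⟩ := exists_diagonal b (fun j => h (ev j)) M hM
    refine ⟨D, fun μ x hx => ?_⟩
    apply b.repr.injective
    ext i
    rw [map_smul, lp.coeFn_smul, Pi.smul_apply, b.repr_apply_apply, b.repr_apply_apply,
      inner_diagonal b hD, smul_eq_mul]
    have h1 := inner_diagonal b hb i x
    rw [hx, inner_smul_right] at h1
    rcases mul_eq_mul_right_iff.1 h1 with h2 | h2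
    · rw [h2]
    · rw [h2, mul_zero, mul_zero]
  rw [opFun, dif_pos hex]
  exact Classical.choose_spec hex _ _ (hb j)

end Operators

section Eigenbasis

variable {H K J : Type*} [NormedAddCommGroup H] [InnerProductSpace ℝ H] [CompleteSpace H]
  [NormedAddCommGroup K] [InnerProductSpace ℝ K] [CompleteSpace K]
  {T : H →L[ℝ] K} {b : HilbertBasis J ℝ H} {ev : J → ℝ}

/-! ### Variances, bias and effective dimension in an eigenbasis -/

lemma inner_apply_apply_eigenbasis (hb : ∀ j, companion T (b j) = ev j • b j) (j : J) (x : H) :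
    ⟪T (b j), T x⟫_ℝ = ev j * ⟪b j, x⟫_ℝ := by
  rw [← ContinuousLinearMap.adjoint_inner_left, ← real_inner_smul_left, ← hb]
  rfl

lemma norm_sq_apply_eigenbasis (hb : ∀ j, companion T (b j) = ev j • b j) (j : J) :
    ‖T (b j)‖ ^ 2 = ev j := by
  rw [← real_inner_self_eq_norm_sq, inner_apply_apply_eigenbasis hb, real_inner_self_eq_norm_sq,
    b.orthonormal.1, one_pow, mul_one]

lemma ev_nonneg (hb : ∀ j, companion T (b j) = ev j • b j) (j : J) : 0 ≤ ev j := by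
  rw [← norm_sq_apply_eigenbasis hb]
  exact sq_nonneg _

lemma ev_mem_Icc (hb : ∀ j, companion T (b j) = ev j • b j) (j : J) :
    ev j ∈ Icc 0 ‖companion T‖ := by
  refine ⟨ev_nonneg hb j, ?_⟩
  have h := (companion T).le_opNorm (b j)
  rwa [hb, norm_smul, b.orthonormal.1, mul_one, mul_one, Real.norm_of_nonneg (ev_nonneg hb j)] at h

lemma ev_eq_zero_or_mem_Ioc (hb : ∀ j, companion T (b j) = ev j • b j) (j : J) :
    ev j = 0 ∨ ev j ∈ Ioc 0 ‖companion T‖ := by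
  rcases (ev_nonneg hb j).eq_or_lt with h | h
  · exact Or.inl h.symm
  · exact Or.inr ⟨h, (ev_mem_Icc hb j).2⟩

variable {g : ℝ → ℝ → ℝ} {γs τ : ℝ}

/-- `g_τ(T* T)` acts as multiplication by `g τ` in the eigenbasis. No hypothesis restricts `g τ 0`,
but as a single value it does not affect the boundedness of `g τ` on the eigenvalues. -/
lemma opFun_regularization_basis (hb : ∀ j, companion T (b j) = ev j • b j)
    (hγ : IsGrowthConstant ‖companion T‖ g γs) (hτ : 0 < τ) (j : J) :
    opFun (companion T) (g τ) (b j) = g τ (ev j) • b j := by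
  refine opFun_basis b hb (M := max (γs / τ) |g τ 0|) (fun j => ?_) j
  rcases ev_eq_zero_or_mem_Ioc hb j with h | h
  · rw [h]
    exact le_max_right _ _
  · refine le_max_of_le_left ?_
    rw [le_div_iff₀ hτ, mul_comm]
    exact hγ.param_le τ hτ _ h

lemma adjoint_reconstruction_basis (hb : ∀ j, companion T (b j) = ev j • b j)
    (hγ : IsGrowthConstant ‖companion T‖ g γs) (hτ : 0 < τ) (j : J) :
    ContinuousLinearMap.adjoint (reconstruction T g τ) (b j) = g τ (ev j) • T (b j) := by
  have hG := opFun_regularization_basis hb hγ hτ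
  rw [reconstruction, ContinuousLinearMap.adjoint_comp, ContinuousLinearMap.adjoint_adjoint,
    adjoint_diagonal b hG, ContinuousLinearMap.comp_apply, hG, map_smul]

lemma reconstruction_apply_basis (hb : ∀ j, companion T (b j) = ev j • b j)
    (hγ : IsGrowthConstant ‖companion T‖ g γs) (hτ : 0 < τ) (j : J) :
    reconstruction T g τ (T (b j)) = (ev j * g τ (ev j)) • b j := by
  have hG := opFun_regularization_basis hb hγ hτ
  change opFun (companion T) (g τ) (companion T (b j)) = _
  rw [hb, map_smul, hG, smul_smul]

lemma inner_adjoint_reconstruction_basis (hb : ∀ j, companion T (b j) = ev j • b j)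
    (hγ : IsGrowthConstant ‖companion T‖ g γs) (hτ : 0 < τ) {i j : J} (hij : i ≠ j) :
    ⟪ContinuousLinearMap.adjoint (reconstruction T g τ) (b i),
      ContinuousLinearMap.adjoint (reconstruction T g τ) (b j)⟫_ℝ = 0 := by
  rw [adjoint_reconstruction_basis hb hγ hτ, adjoint_reconstruction_basis hb hγ hτ,
    real_inner_smul_left, real_inner_smul_right, inner_apply_apply_eigenbasis hb,
    b.orthonormal.2 hij]
  simp

lemma norm_sq_adjoint_reconstruction_basis (hb : ∀ j, companion T (b j) = ev j • b j)
    (hγ : IsGrowthConstant ‖companion T‖ g γs) (hτ : 0 < τ) (j : J) :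
    ‖ContinuousLinearMap.adjoint (reconstruction T g τ) (b j)‖ ^ 2 = g τ (ev j) ^ 2 * ev j := by
  rw [adjoint_reconstruction_basis hb hγ hτ, norm_smul, mul_pow, norm_sq_apply_eigenbasis hb,
    Real.norm_eq_abs, sq_abs]

lemma IsGrowthConstant.sq_mul_le (hγ : IsGrowthConstant ‖companion T‖ g γs) (hτ : 0 < τ) {t : ℝ}
    (ht : t = 0 ∨ t ∈ Ioc 0 ‖companion T‖) : τ * (g τ t ^ 2 * t) ≤ γs ^ 2 := by
  rcases ht with rfl | ht
  · simpa using sq_nonneg γs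
  · calc τ * (g τ t ^ 2 * t) = (τ * |g τ t|) * (t * |g τ t|) := by
          rw [← sq_abs]; ring
      _ ≤ γs * γs := by
          have := ht.1
          gcongr
          · linarith [hγ.one_le]
          · exact hγ.param_le τ hτ t ht
          · exact hγ.arg_le τ hτ t ht
      _ = γs ^ 2 := by ring

/-- The contribution of an eigenvalue `t` to `tr (R* R)` is dominated by its contribution to the
effective dimension. -/
lemma IsGrowthConstant.sq_mul_le_div (hγ : IsGrowthConstant ‖companion T‖ g γs) (hτ : 0 < τ)
    {t : ℝ} (ht : t = 0 ∨ t ∈ Ioc 0 ‖companion T‖) :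
    g τ t ^ 2 * t ≤ 2 * γs ^ 2 / τ * (t / (t + τ)) := by
  have h1 := hγ.sq_mul_le hτ ht
  rcases ht with rfl | ht
  · simp
  have h2 : τ ^ 2 * g τ t ^ 2 ≤ γs ^ 2 := by
    rw [← sq_abs (g τ t), ← mul_pow]
    have := hγ.param_le τ hτ t ht
    gcongr
  have h3 : 0 < t := ht.1
  rw [div_mul_div_comm, le_div_iff₀ (by positivity)]
  nlinarith

/-- The trace that defines the effective dimension, as a series over the eigenvalues. -/
lemma posTrace_inverse_mul_companion_eq (hb : ∀ j, companion T (b j) = ev j • b j) (hτ : 0 < τ) :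
    posTrace (Ring.inverse (companion T + τ • ContinuousLinearMap.id ℝ H) * companion T) =
      ∑' j, ENNReal.ofReal (ev j / (ev j + τ)) := by
  have hpos (j : J) : 0 < ev j + τ := add_pos_of_nonneg_of_pos (ev_nonneg hb j) hτ
  obtain ⟨D, hD⟩ := exists_diagonal b (fun j => 1 / (ev j + τ)) (1 / τ) fun j => by
    rw [abs_of_nonneg (by have := hpos j; positivity)]
    exact one_div_le_one_div_of_le hτ (by linarith [ev_nonneg hb j])
  have hsum (j : J) : (companion T + τ • ContinuousLinearMap.id ℝ H) (b j) = (ev j + τ) • b j := by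
    simp [hb, add_smul]
  have h1 : (companion T + τ • ContinuousLinearMap.id ℝ H) * D = 1 := by
    refine clm_ext_of_basis b fun j => ?_
    rw [mul_apply_eq_comp, hD, map_smul, hsum, smul_smul,
      one_div_mul_cancel (hpos j).ne', one_smul, one_apply_eq_self]
  have h2 : D * (companion T + τ • ContinuousLinearMap.id ℝ H) = 1 := by
    refine clm_ext_of_basis b fun j => ?_
    rw [mul_apply_eq_comp, hsum, map_smul, hD, smul_smul,
      mul_one_div_cancel (hpos j).ne', one_smul, one_apply_eq_self]
  have hinv : Ring.inverse (companion T + τ • ContinuousLinearMap.id ℝ H) = D :=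
    Ring.inverse_unit ⟨_, D, h1, h2⟩
  -- The trace of `E ∘ E` for the diagonal square root `E` is a squared Hilbert–Schmidt norm.
  obtain ⟨E, hE⟩ := exists_diagonal b (fun j => √(ev j / (ev j + τ))) 1 fun j => by
    rw [abs_of_nonneg (Real.sqrt_nonneg _), Real.sqrt_le_one, div_le_one (hpos j)]
    linarith
  have h3 : D * companion T = companion E := by
    refine clm_ext_of_basis b fun j => ?_
    have hnn : 0 ≤ ev j / (ev j + τ) := div_nonneg (ev_nonneg hb j) (hpos j).le
    change D (companion T (b j)) = ContinuousLinearMap.adjoint E (E (b j))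
    rw [adjoint_diagonal b hE, hE, map_smul, hE, smul_smul, Real.mul_self_sqrt hnn, hb, map_smul,
      hD, smul_smul, mul_one_div]
  rw [hinv, h3, posTrace_companion_eq b]
  refine tsum_congr fun j => ?_
  have hnn : 0 ≤ ev j / (ev j + τ) := div_nonneg (ev_nonneg hb j) (hpos j).le
  rw [hE, norm_smul, b.orthonormal.1, mul_one, Real.norm_eq_abs, sq_abs, Real.sq_sqrt hnn]

lemma tsum_ev_div_lt_top (hT : IsHilbertSchmidt T) (hb : ∀ j, companion T (b j) = ev j • b j)
    (hτ : 0 < τ) : ∑' j, ENNReal.ofReal (ev j / (ev j + τ)) < ∞ := by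
  rw [IsHilbertSchmidt, posTrace_companion_eq b] at hT
  simp_rw [norm_sq_apply_eigenbasis hb] at hT
  calc ∑' j, ENNReal.ofReal (ev j / (ev j + τ))
      ≤ ∑' j, ENNReal.ofReal (1 / τ) * ENNReal.ofReal (ev j) := by
        refine ENNReal.tsum_le_tsum fun j => ?_
        have := ev_nonneg hb j
        rw [← ENNReal.ofReal_mul (by positivity), one_div_mul_eq_div]
        exact ENNReal.ofReal_le_ofReal (div_le_div_of_nonneg_left this hτ (by linarith))
    _ = ENNReal.ofReal (1 / τ) * ∑' j, ENNReal.ofReal (ev j) := ENNReal.tsum_mul_left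
    _ < ∞ := ENNReal.mul_lt_top ENNReal.ofReal_lt_top hT

lemma posTrace_reconstruction_le (hT : IsHilbertSchmidt T)
    (hb : ∀ j, companion T (b j) = ev j • b j)
    (hγ : IsGrowthConstant ‖companion T‖ g γs) (hτ : 0 < τ) :
    posTrace (companion (reconstruction T g τ)) ≤
      ENNReal.ofReal (2 * γs ^ 2 / τ * effectiveDim T τ) := by
  rw [ENNReal.ofReal_mul (by positivity), effectiveDim, posTrace_inverse_mul_companion_eq hb hτ,
    ENNReal.ofReal_toReal (tsum_ev_div_lt_top hT hb hτ).ne, ← ENNReal.tsum_mul_left,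
    posTrace_companion_eq_adjoint b]
  refine ENNReal.tsum_le_tsum fun j => ?_
  rw [← ENNReal.ofReal_mul (by positivity), norm_sq_adjoint_reconstruction_basis hb hγ hτ]
  exact ENNReal.ofReal_le_ofReal (hγ.sq_mul_le_div hτ (ev_eq_zero_or_mem_Ioc hb j))

lemma effectiveDim_nonneg (T : H →L[ℝ] K) (τ : ℝ) : 0 ≤ effectiveDim T τ := ENNReal.toReal_nonneg

lemma strongVar_reconstruction_le (hT : IsHilbertSchmidt T)
    (hγ : IsGrowthConstant ‖companion T‖ g γs) (hτ : 0 < τ) (σ : ℝ) :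
    strongVar σ (reconstruction T g τ) ≤ σ ^ 2 * (2 * γs ^ 2 / τ * effectiveDim T τ) := by
  obtain ⟨J, b, ev, hb⟩ := exists_eigenbasis hT
  have := effectiveDim_nonneg T τ
  exact mul_le_mul_of_nonneg_left
    (ENNReal.toReal_le_of_le_ofReal (by positivity) (posTrace_reconstruction_le hT hb hγ hτ))
    (sq_nonneg _)

lemma norm_reconstruction_sq_le (hT : IsHilbertSchmidt T)
    (hγ : IsGrowthConstant ‖companion T‖ g γs) (hτ : 0 < τ) :
    ‖reconstruction T g τ‖ ^ 2 ≤ γs ^ 2 / τ := by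
  obtain ⟨J, b, ev, hb⟩ := exists_eigenbasis hT
  set R := reconstruction T g τ with hR
  have hD (j : J) : (R ∘L ContinuousLinearMap.adjoint R) (b j) = (g τ (ev j) ^ 2 * ev j) • b j := by
    rw [ContinuousLinearMap.comp_apply, adjoint_reconstruction_basis hb hγ hτ, map_smul,
      reconstruction_apply_basis hb hγ hτ, smul_smul]
    congr 1
    ring
  have hle : ‖R ∘L ContinuousLinearMap.adjoint R‖ ≤ γs ^ 2 / τ := by
    refine ContinuousLinearMap.opNorm_le_bound _ (by positivity) fun x =>
      norm_diagonal_le b hD (by positivity) (fun j => ?_) x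
    rw [abs_of_nonneg (mul_nonneg (sq_nonneg _) (ev_nonneg hb j)), le_div_iff₀ hτ, mul_comm]
    exact hγ.sq_mul_le hτ (ev_eq_zero_or_mem_Ioc hb j)
  have hCstar := ContinuousLinearMap.norm_adjoint_comp_self (ContinuousLinearMap.adjoint R)
  rw [ContinuousLinearMap.adjoint_adjoint, LinearIsometryEquiv.norm_map] at hCstar
  rwa [sq, ← hCstar]

lemma weakVar_le_strongVar (σ : ℝ) {R : K →L[ℝ] H} (hR : IsHilbertSchmidt R) :
    weakVar σ R ≤ strongVar σ R := by
  refine mul_le_mul_of_nonneg_left ?_ (sq_nonneg σ)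
  have h := ofReal_opNorm_sq_le R
  rwa [← ENNReal.ofReal_toReal hR.ne, ENNReal.ofReal_le_ofReal_iff ENNReal.toReal_nonneg] at h

lemma isHilbertSchmidt_reconstruction (hT : IsHilbertSchmidt T)
    (hγ : IsGrowthConstant ‖companion T‖ g γs) (hτ : 0 < τ) :
    IsHilbertSchmidt (reconstruction T g τ) := by
  obtain ⟨J, b, ev, hb⟩ := exists_eigenbasis hT
  exact (posTrace_reconstruction_le hT hb hγ hτ).trans_lt ENNReal.ofReal_lt_top

/-- The bias of the reconstruction on the source set is controlled by the qualification. -/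
lemma norm_sub_reconstruction_le (hT : IsHilbertSchmidt T)
    (hγ : IsGrowthConstant ‖companion T‖ g γs) (hτ : 0 < τ) {φ : ℝ → ℝ} {γ : ℝ}
    (hφ : IsIndexFunction φ) (hq : HasQualification ‖companion T‖ g φ γ) {f : H}
    (hf : f ∈ sourceSet T φ) : ‖f - reconstruction T g τ (T f)‖ ≤ γ * φ τ := by
  obtain ⟨J, b, ev, hb⟩ := exists_eigenbasis hT
  obtain ⟨w, hw, rfl⟩ := hf
  have hφ0 {t : ℝ} (ht : 0 ≤ t) : 0 ≤ φ t := by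
    have := hφ.monotoneOn self_mem_Ici ht ht
    rwa [hφ.map_zero] at this
  have hφb (j : J) : opFun (companion T) φ (b j) = φ (ev j) • b j := by
    refine opFun_basis b hb (M := φ ‖companion T‖) (fun j => ?_) j
    rw [abs_of_nonneg (hφ0 (ev_nonneg hb j))]
    exact hφ.monotoneOn (ev_nonneg hb j) (norm_nonneg (companion T)) (ev_mem_Icc hb j).2
  let D : H →L[ℝ] H := opFun (companion T) φ -
    (reconstruction T g τ ∘L T) ∘L opFun (companion T) φ
  have hD (j : J) : D (b j) = (residualFn g τ (ev j) * φ (ev j)) • b j := by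
    simp only [D, _root_.sub_apply, ContinuousLinearMap.comp_apply, hφb, map_smul,
      reconstruction_apply_basis hb hγ hτ, residualFn, smul_smul, ← sub_smul]
    congr 1
    ring
  have h0 : 0 ≤ γ * φ τ := by
    have := hq τ hτ 0 ⟨le_rfl, norm_nonneg _⟩
    rwa [hφ.map_zero, mul_zero] at this
  refine (norm_diagonal_le b hD h0 (fun j => ?_) w).trans (mul_le_of_le_one_right h0 hw)
  rw [abs_mul, abs_of_nonneg (hφ0 (ev_nonneg hb j))]
  exact hq τ hτ _ (ev_mem_Icc hb j)

end Eigenbasis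

section Radius

variable {H K : Type*} [NormedAddCommGroup H] [InnerProductSpace ℝ H] [CompleteSpace H]
  [NormedAddCommGroup K] [InnerProductSpace ℝ K] [CompleteSpace K]

/-! ### The radius at the balancing parameter -/

lemma isGrowthConstant_max {a γ₁ γ₀ : ℝ} {g : ℝ → ℝ → ℝ} (hg : IsRegularization a g γ₁ γ₀) :
    IsGrowthConstant a g (max γ₀ (1 + γ₁)) where
  one_le := le_max_of_le_left hg.one_le
  param_le τ hτ t ht := le_max_of_le_left (hg.growth_le τ hτ t ht)
  arg_le τ hτ t ht := by
    rcases le_or_gt τ a with h | h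
    · refine le_max_of_le_right ?_
      have h1 := hg.residual_le τ ⟨hτ, h⟩ t ⟨ht.1.le, ht.2⟩
      rw [residualFn] at h1
      calc t * |g τ t| = |t * g τ t| := by rw [abs_mul, abs_of_pos ht.1]
        _ = |1 - (1 - t * g τ t)| := by rw [sub_sub_cancel]
        _ ≤ |1| + |1 - t * g τ t| := abs_sub _ _
        _ ≤ 1 + γ₁ := by rw [abs_one]; gcongr
    -- The residual is only bounded for `τ ≤ a`; for `τ > a` one has `t ≤ τ`.
    · refine le_max_of_le_left ((mul_le_mul_of_nonneg_right ?_ (abs_nonneg _)).trans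
        (hg.growth_le τ hτ t ht))
      exact ht.2.trans h.le

lemma logLevel_nonneg {α : ℝ} (hα : α ∈ Ioo (0 : ℝ) 1) : 0 ≤ logLevel α :=
  Real.log_nonneg ((one_le_div hα.1).2 hα.2.le)

lemma exp_neg_logLevel {α : ℝ} (hα : α ∈ Ioo (0 : ℝ) 1) : Real.exp (-logLevel α) = α := by
  rw [logLevel, one_div, Real.log_inv, neg_neg, Real.exp_log hα.1]

lemma Cstar_nonneg (α β : ℝ) : 0 ≤ Cstar α β := by
  unfold Cstar
  positivity

omit [CompleteSpace H] [CompleteSpace K] in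
lemma weakVar_nonneg (σ : ℝ) (R : K →L[ℝ] H) : 0 ≤ weakVar σ R := by
  unfold weakVar
  positivity

lemma strongVar_nonneg (σ : ℝ) (R : K →L[ℝ] H) : 0 ≤ strongVar σ R :=
  mul_nonneg (sq_nonneg _) ENNReal.toReal_nonneg

lemma radiusSq_nonneg {α β : ℝ} (hα : α ∈ Ioo (0 : ℝ) 1) (hβ : β ∈ Ioo (0 : ℝ) 1) (σ : ℝ)
    (R : K →L[ℝ] H) : 0 ≤ radiusSq σ α β R := by
  have h1 := logLevel_nonneg hα
  have h2 := logLevel_nonneg hβ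
  have h3 := weakVar_nonneg σ R
  have h4 := Cstar_nonneg α β
  unfold radiusSq
  positivity

/-- At the parameter that balances `φ²` with `σ² √𝒩 / τ`, the radius is of the order of `φ²`. -/
lemma radiusSq_le {T : H →L[ℝ] K} (hT : IsHilbertSchmidt T) {g : ℝ → ℝ → ℝ} {γs τ σ p α β : ℝ}
    (hγ : IsGrowthConstant ‖companion T‖ g γs) (hτ : 0 < τ)
    (hα : α ∈ Ioo (0 : ℝ) 1) (hβ : β ∈ Ioo (0 : ℝ) 1)
    (hp : p ^ 2 = σ ^ 2 * (√(effectiveDim T τ) / τ)) :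
    radiusSq σ α β (reconstruction T g τ) ≤ (Cstar α β * √2 * γs ^ 2 +
      (4 * logLevel α + 8 * logLevel β) * γs ^ 2 / √(effectiveDim T τ)) * p ^ 2 := by
  set R := reconstruction T g τ
  have hS := strongVar_reconstruction_le hT hγ hτ σ
  have hv : weakVar σ R ≤ σ ^ 2 * (γs ^ 2 / τ) :=
    mul_le_mul_of_nonneg_left (norm_reconstruction_sq_le hT hγ hτ) (sq_nonneg σ)
  have hvS := weakVar_le_strongVar σ (isHilbertSchmidt_reconstruction hT hγ hτ)
  have hv0 := weakVar_nonneg σ R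
  have hN := effectiveDim_nonneg T τ
  have hγ0 : 0 ≤ γs := zero_le_one.trans hγ.one_le
  have hSv : √(strongVar σ R) * √(weakVar σ R) ≤ √2 * γs ^ 2 * p ^ 2 := by
    rw [← Real.sqrt_mul (strongVar_nonneg _ _)]
    refine Real.sqrt_le_iff.2 ⟨by positivity, ?_⟩
    calc strongVar σ R * weakVar σ R
        ≤ (σ ^ 2 * (2 * γs ^ 2 / τ * effectiveDim T τ)) * (σ ^ 2 * (γs ^ 2 / τ)) := by gcongr
      _ = (√2 * γs ^ 2 * p ^ 2) ^ 2 := by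
        rw [hp]
        simp only [mul_pow, div_pow]
        rw [Real.sq_sqrt hN, Real.sq_sqrt zero_le_two]
        ring
  have hvp : weakVar σ R ≤ γs ^ 2 / √(effectiveDim T τ) * p ^ 2 := by
    rcases hN.eq_or_lt with h0 | h0
    · have : weakVar σ R ≤ 0 := by
        refine hvS.trans (hS.trans_eq ?_)
        rw [← h0]
        ring
      rw [← h0]
      simpa using this
    · refine hv.trans_eq ?_
      have := (Real.sqrt_pos.2 h0).ne'
      rw [hp]
      field_simp
  have hc : 0 ≤ 4 * logLevel α + 8 * logLevel β := by
    linarith [logLevel_nonneg hα, logLevel_nonneg hβ]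
  calc radiusSq σ α β R
      = Cstar α β * (√(strongVar σ R) * √(weakVar σ R)) +
        (4 * logLevel α + 8 * logLevel β) * weakVar σ R := by rw [radiusSq]; ring
    _ ≤ Cstar α β * (√2 * γs ^ 2 * p ^ 2) +
        (4 * logLevel α + 8 * logLevel β) * (γs ^ 2 / √(effectiveDim T τ) * p ^ 2) := by
      have := Cstar_nonneg α β
      gcongr
    _ = _ := by ring

end Radius

/-! ### Exponential moments of squared Gaussian variables -/

section GaussianSquares

variable {Ω J : Type*} [MeasurableSpace Ω] {P : Measure Ω}

/-- Tilting the Gaussian density by `exp (t x²)` gives a multiple of another Gaussian density. -/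
lemma gaussianPDFReal_mul_exp_sq (m : ℝ) {v : ℝ≥0} (hv : v ≠ 0) {t : ℝ} (ht : 0 < 1 - 2 * t * v)
    (x : ℝ) : gaussianPDFReal m v x * Real.exp (t * x ^ 2) =
      ((√(1 - 2 * t * v))⁻¹ * Real.exp (t * m ^ 2 / (1 - 2 * t * v))) *
        gaussianPDFReal (m / (1 - 2 * t * v)) (v / (1 - 2 * t * v).toNNReal) x := by
  have hv0 : (0 : ℝ) < v := by positivity
  set d := 1 - 2 * t * v with hd
  have hcoe : ((v / d.toNNReal : ℝ≥0) : ℝ) = v / d := by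
    rw [NNReal.coe_div, Real.coe_toNNReal _ ht.le]
  simp only [gaussianPDFReal, hcoe]
  rw [mul_assoc, ← Real.exp_add, mul_mul_mul_comm, ← Real.exp_add, ← mul_inv, ← Real.sqrt_mul ht.le]
  congr 2
  · congr 1
    field_simp
  · field_simp
    rw [hd]
    ring

lemma integral_exp_sq_gaussianReal (m : ℝ) {v : ℝ≥0} (hv : v ≠ 0) {t : ℝ}
    (ht : 0 < 1 - 2 * t * v) : ∫ x, Real.exp (t * x ^ 2) ∂gaussianReal m v =
      (√(1 - 2 * t * v))⁻¹ * Real.exp (t * m ^ 2 / (1 - 2 * t * v)) := by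
  rw [integral_gaussianReal_eq_integral_smul hv]
  simp_rw [smul_eq_mul, gaussianPDFReal_mul_exp_sq m hv ht]
  rw [integral_const_mul, integral_gaussianPDFReal_eq_one, mul_one]
  exact div_ne_zero hv (Real.toNNReal_pos.2 ht).ne'

lemma mgf_sq_of_hasLaw_gaussianReal {Y : Ω → ℝ} {m : ℝ} {v : ℝ≥0}
    (hY : HasLaw Y (gaussianReal m v) P) (hv : v ≠ 0) {t : ℝ} (ht : 0 < 1 - 2 * t * v) :
    mgf (fun ω => Y ω ^ 2) P t =
      (√(1 - 2 * t * v))⁻¹ * Real.exp (t * m ^ 2 / (1 - 2 * t * v)) := by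
  rw [← integral_exp_sq_gaussianReal m hv ht]
  exact hY.integral_comp (f := fun x => Real.exp (t * x ^ 2))
    (by fun_prop : Measurable _).aestronglyMeasurable

/-- With `u = t v`, the sub-gamma bound of the exponential moment of a centred squared Gaussian. -/
lemma inv_sqrt_one_sub_le {u : ℝ} (h0 : 0 ≤ u) (h1 : 0 < 1 - 2 * u) :
    (√(1 - 2 * u))⁻¹ ≤ Real.exp (u + u ^ 2 / (1 - 2 * u)) := by
  set w := 1 - 2 * u with hw
  -- `-log w ≤ (w⁻¹ - w) / 2` is `x ≤ sinh x` at `x = -log w`.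
  have hsinh : -Real.log w ≤ Real.sinh (-Real.log w) :=
    Real.self_le_sinh_iff.2 (neg_nonneg.2 (Real.log_nonpos h1.le (by linarith)))
  rw [Real.sinh_eq, neg_neg, Real.exp_neg, Real.exp_log h1] at hsinh
  have h2 : u + u ^ 2 / w = (w⁻¹ - w) / 4 := by
    have : u = (1 - w) / 2 := by linarith
    rw [this]
    field_simp
    ring
  rw [h2, ← Real.exp_log (inv_pos.2 (Real.sqrt_pos.2 h1)), Real.exp_le_exp, Real.log_inv,
    Real.log_sqrt h1.le]
  linarith

/-- With `u = t v`, the bound of the exponential moment of a squared Gaussian at `-t`. -/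
lemma inv_sqrt_one_add_le {u : ℝ} (h0 : 0 ≤ u) :
    (√(1 + 2 * u))⁻¹ ≤ Real.exp (-u + u ^ 2) := by
  have h1 : 0 < 1 + 2 * u := by linarith
  have hlog := Real.le_log_one_add_of_nonneg (x := 2 * u) (by linarith)
  have h2 : 2 * (u - u ^ 2) ≤ 2 * (2 * u) / (2 * u + 2) := by
    rw [le_div_iff₀ (by linarith)]
    nlinarith [pow_nonneg h0 3]
  rw [← Real.exp_log (inv_pos.2 (Real.sqrt_pos.2 h1)), Real.exp_le_exp, Real.log_inv,
    Real.log_sqrt h1.le]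
  linarith

variable {Y : J → Ω → ℝ} {m : J → ℝ} {v : J → ℝ≥0}

lemma mgf_sum_sq (hY : ∀ j, HasLaw (Y j) (gaussianReal (m j) (v j)) P)
    (hind : iIndepFun Y P) (hv : ∀ j, v j ≠ 0) (s : Finset J) {t : ℝ}
    (ht : ∀ j, 0 < 1 - 2 * t * v j) :
    mgf (fun ω => ∑ j ∈ s, Y j ω ^ 2) P t =
      ∏ j ∈ s, (√(1 - 2 * t * v j))⁻¹ * Real.exp (t * m j ^ 2 / (1 - 2 * t * v j)) := by
  have hsq : iIndepFun (fun j ω => Y j ω ^ 2) P :=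
    hind.comp (fun _ x => x ^ 2) fun _ => by fun_prop
  have h := hsq.mgf_sum₀ (t := t) (fun j => (hY j).aemeasurable.pow_const 2) s
  rw [show (fun ω => ∑ j ∈ s, Y j ω ^ 2) = ∑ j ∈ s, fun ω => Y j ω ^ 2 by ext; simp, h]
  exact Finset.prod_congr rfl fun j _ => mgf_sq_of_hasLaw_gaussianReal (hY j) (hv j) (ht j)

lemma integrable_exp_sum_sq (hY : ∀ j, HasLaw (Y j) (gaussianReal (m j) (v j)) P)
    (hind : iIndepFun Y P) (hv : ∀ j, v j ≠ 0) (s : Finset J) {t : ℝ}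
    (ht : ∀ j, 0 < 1 - 2 * t * v j) :
    Integrable (fun ω => Real.exp (t * ∑ j ∈ s, Y j ω ^ 2)) P := by
  -- The integral of a non-integrable function is `0`, but this one is positive.
  by_contra hn
  have h := mgf_sum_sq hY hind hv s ht
  rw [mgf, integral_undef hn] at h
  refine h.not_lt (Finset.prod_pos fun j _ => ?_)
  have := Real.sqrt_pos.2 (ht j)
  positivity

/-- Upper tail of a finite sum of independent centred squared Gaussian variables. -/
lemma measureReal_sum_sq_ge_le [IsProbabilityMeasure P]
    (hY : ∀ j, HasLaw (Y j) (gaussianReal 0 (v j)) P)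
    (hind : iIndepFun Y P) (hv : ∀ j, v j ≠ 0) (s : Finset J) {S c x : ℝ} (hS : 0 < S) (hc : 0 < c)
    (hx : 0 ≤ x) (hvS : ∑ j ∈ s, (v j : ℝ) ≤ S) (hvc : ∀ j, (v j : ℝ) ≤ c) :
    P.real {ω | S + 2 * √S * √c * √x + 2 * c * x ≤ ∑ j ∈ s, Y j ω ^ 2} ≤ Real.exp (-x) := by
  set w := √S * √c with hw
  set r := √x with hr
  have hw0 : 0 < w := mul_pos (Real.sqrt_pos.2 hS) (Real.sqrt_pos.2 hc)
  have hr0 : 0 ≤ r := Real.sqrt_nonneg _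
  have hw2 : w ^ 2 = S * c := by rw [hw, mul_pow, Real.sq_sqrt hS.le, Real.sq_sqrt hc.le]
  have hr2 : r ^ 2 = x := Real.sq_sqrt hx
  have hD : 0 < w + 2 * c * r := by positivity
  -- the optimal exponent in Bernstein's inequality
  set t := r / (w + 2 * c * r) with ht
  have ht0 : 0 ≤ t := by positivity
  have htD : t * (w + 2 * c * r) = r := div_mul_cancel₀ _ hD.ne'
  have htc : 1 - 2 * t * c = w / (w + 2 * c * r) := by
    rw [ht]
    field_simp
    ring
  have htc0 : 0 < 1 - 2 * t * c := by rw [htc]; positivity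
  have htv (j : J) : 1 - 2 * t * c ≤ 1 - 2 * t * v j := by
    have := mul_le_mul_of_nonneg_left (hvc j) ht0
    linarith
  have htv0 (j : J) : 0 < 1 - 2 * t * v j := htc0.trans_le (htv j)
  refine (measure_ge_le_exp_mul_mgf _ ht0 (integrable_exp_sum_sq hY hind hv s htv0)).trans ?_
  have hprod : mgf (fun ω => ∑ j ∈ s, Y j ω ^ 2) P t ≤
      Real.exp (t * S + t ^ 2 * c / (1 - 2 * t * c) * S) := by
    rw [mgf_sum_sq hY hind hv s htv0]
    calc ∏ j ∈ s, (√(1 - 2 * t * v j))⁻¹ * Real.exp (t * 0 ^ 2 / (1 - 2 * t * v j))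
        ≤ ∏ j ∈ s, Real.exp ((t + t ^ 2 * c / (1 - 2 * t * c)) * v j) := by
          refine Finset.prod_le_prod (fun j _ => by positivity) fun j _ => ?_
          have h1 := inv_sqrt_one_sub_le (u := t * v j) (by positivity)
            (by have := htv0 j; linarith)
          rw [← mul_assoc 2 t] at h1
          rw [show t * (0 : ℝ) ^ 2 / (1 - 2 * t * v j) = 0 by simp, Real.exp_zero, mul_one]
          refine h1.trans (Real.exp_le_exp.2 ?_)
          have h2 : (t * v j) ^ 2 / (1 - 2 * t * v j) ≤ t ^ 2 * c * v j / (1 - 2 * t * c) := by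
            refine div_le_div₀ (by positivity) ?_ htc0 (htv j)
            rw [mul_pow, sq (v j : ℝ), ← mul_assoc, mul_assoc (t ^ 2), mul_assoc (t ^ 2)]
            have := hvc j
            gcongr
          calc _ ≤ t * v j + t ^ 2 * c * v j / (1 - 2 * t * c) := by gcongr
            _ = _ := by ring
      _ = Real.exp ((t + t ^ 2 * c / (1 - 2 * t * c)) * ∑ j ∈ s, (v j : ℝ)) := by
          rw [← Real.exp_sum, Finset.mul_sum]
      _ ≤ Real.exp ((t + t ^ 2 * c / (1 - 2 * t * c)) * S) := by gcongr
      _ = _ := by rw [add_mul]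
  calc _ ≤ Real.exp (-t * (S + 2 * √S * √c * r + 2 * c * x)) *
        Real.exp (t * S + t ^ 2 * c / (1 - 2 * t * c) * S) := by gcongr
    _ = Real.exp (-x) := by
      rw [← Real.exp_add]
      congr 1
      have h3 : t ^ 2 * c / (1 - 2 * t * c) * S = t * r * w := by
        rw [htc, div_mul_eq_mul_div, mul_assoc, mul_comm c S, ← hw2, div_div_eq_mul_div,
          div_eq_iff hw0.ne']
        calc t ^ 2 * w ^ 2 * (w + 2 * c * r) = t * w ^ 2 * (t * (w + 2 * c * r)) := by ring
          _ = _ := by rw [htD]; ring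
      rw [h3, mul_assoc 2 √S, ← hw, ← hr2]
      calc _ = -(r * (t * (w + 2 * c * r))) := by ring
        _ = -r ^ 2 := by rw [htD]; ring

/-- Exponential lower tail of a finite sum of independent squared Gaussian variables, which need
not be centred. -/
lemma measureReal_sum_sq_le_le [IsProbabilityMeasure P]
    (hY : ∀ j, HasLaw (Y j) (gaussianReal (m j) (v j)) P)
    (hind : iIndepFun Y P) (hv : ∀ j, v j ≠ 0) (s : Finset J) {t : ℝ} (ht : 0 ≤ t) (q : ℝ) :
    P.real {ω | ∑ j ∈ s, Y j ω ^ 2 ≤ q} ≤ Real.exp (t * q - t * ∑ j ∈ s, (v j + m j ^ 2) +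
      t ^ 2 * ∑ j ∈ s, ((v j : ℝ) ^ 2 + 2 * v j * m j ^ 2)) := by
  have hd (j : J) : (1 : ℝ) ≤ 1 - 2 * (-t) * v j := by
    have : 0 ≤ t * v j := by positivity
    linarith
  have hd0 (j : J) : 0 < 1 - 2 * (-t) * v j := zero_lt_one.trans_le (hd j)
  refine (measure_le_le_exp_mul_mgf q (neg_nonpos.2 ht)
    (integrable_exp_sum_sq hY hind hv s hd0)).trans ?_
  rw [mgf_sum_sq hY hind hv s hd0, neg_neg]
  have hprod : ∏ j ∈ s, (√(1 - 2 * (-t) * v j))⁻¹ * Real.exp (-t * m j ^ 2 / (1 - 2 * (-t) * v j)) ≤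
      ∏ j ∈ s, Real.exp (-t * (v j + m j ^ 2) + t ^ 2 * ((v j : ℝ) ^ 2 + 2 * v j * m j ^ 2)) := by
    refine Finset.prod_le_prod (fun j _ => by positivity) fun j _ => ?_
    have h1 := inv_sqrt_one_add_le (u := t * v j) (by positivity)
    rw [show 1 + 2 * (t * v j) = 1 - 2 * (-t) * v j by ring] at h1
    have h2 : -t * m j ^ 2 / (1 - 2 * (-t) * v j) ≤ -t * m j ^ 2 + 2 * t ^ 2 * v j * m j ^ 2 := by
      rw [div_le_iff₀ (hd0 j)]
      have : 0 ≤ t ^ 3 * (v j : ℝ) ^ 2 * m j ^ 2 := by positivity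
      nlinarith
    calc _ ≤ Real.exp (-(t * v j) + (t * v j) ^ 2) *
          Real.exp (-t * m j ^ 2 + 2 * t ^ 2 * v j * m j ^ 2) := by gcongr
      _ = _ := by
        rw [← Real.exp_add]
        congr 1
        ring
  calc _ ≤ Real.exp (t * q) * ∏ j ∈ s,
        Real.exp (-t * (v j + m j ^ 2) + t ^ 2 * ((v j : ℝ) ^ 2 + 2 * v j * m j ^ 2)) := by gcongr
    _ = _ := by
      rw [← Real.exp_sum, ← Real.exp_add, Finset.sum_add_distrib, ← Finset.mul_sum,
        ← Finset.mul_sum]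
      congr 1
      ring

/-- Upper tail of a countable sum of independent centred squared Gaussian variables with total
variance `S` and variances at most `c`. -/
lemma measureReal_tsum_sq_gt_le [IsProbabilityMeasure P] [Countable J]
    (hY : ∀ j, HasLaw (Y j) (gaussianReal 0 (v j)) P)
    (hind : iIndepFun Y P) (hv : ∀ j, v j ≠ 0) {S c x : ℝ} (hS0 : 0 < S) (hc : 0 < c) (hx : 0 ≤ x)
    (hvS : HasSum (fun j => (v j : ℝ)) S) (hvc : ∀ j, (v j : ℝ) ≤ c) {Q : Ω → ℝ}
    (hQ : ∀ᵐ ω ∂P, HasSum (fun j => Y j ω ^ 2) (Q ω)) :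
    P.real {ω | S + 2 * √S * √c * √x + 2 * c * x < Q ω} ≤ Real.exp (-x) := by
  set q := S + 2 * √S * √c * √x + 2 * c * x
  let A (s : Finset J) : Set Ω := {ω | q ≤ ∑ j ∈ s, Y j ω ^ 2}
  have hmono : Monotone A := fun s s' h ω (hω : q ≤ _) =>
    show q ≤ _ from hω.trans (Finset.sum_le_sum_of_subset_of_nonneg h fun _ _ _ => sq_nonneg _)
  have hsub : ∀ᵐ ω ∂P, ω ∈ {ω | q < Q ω} → ω ∈ ⋃ s, A s := by
    filter_upwards [hQ] with ω hω hq
    obtain ⟨s, hs⟩ := (hω.eventually (lt_mem_nhds hq)).exists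
    exact mem_iUnion.2 ⟨s, hs.le⟩
  have hle : P {ω | q < Q ω} ≤ ENNReal.ofReal (Real.exp (-x)) := by
    refine (measure_mono_ae (t := ⋃ s, A s) hsub).trans ?_
    rw [hmono.directed_le.measure_iUnion]
    refine iSup_le fun s => ?_
    rw [← ofReal_measureReal]
    exact ENNReal.ofReal_le_ofReal (measureReal_sum_sq_ge_le hY hind hv s hS0 hc hx
      (sum_le_hasSum s (fun _ _ => NNReal.coe_nonneg _) hvS) hvc)
  exact ENNReal.toReal_le_of_le_ofReal (Real.exp_pos _).le hle

/-- Lower tail of a countable sum of independent squared Gaussian variables with total variance `S`,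
variances at most `c`, and square-summable means. -/
lemma measureReal_tsum_sq_le_le [IsProbabilityMeasure P] [Countable J]
    (hY : ∀ j, HasLaw (Y j) (gaussianReal (m j) (v j)) P)
    (hind : iIndepFun Y P) (hv : ∀ j, v j ≠ 0) {S c x M q : ℝ} (hc : 0 < c) (hx : 0 ≤ x)
    (hvS : HasSum (fun j => (v j : ℝ)) S) (hvc : ∀ j, (v j : ℝ) ≤ c)
    (hM : HasSum (fun j => m j ^ 2) M) (hM0 : 0 < M) {Q : Ω → ℝ}
    (hQ : ∀ᵐ ω ∂P, HasSum (fun j => Y j ω ^ 2) (Q ω))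
    (hq : q ≤ S + M - 2 * √(c * (S + 2 * M)) * √x) :
    P.real {ω | Q ω ≤ q} ≤ Real.exp (-x) := by
  have hS0 : 0 ≤ S := hvS.nonneg fun _ => NNReal.coe_nonneg _
  set W := c * (S + 2 * M) with hW
  have hW0 : 0 < W := by positivity
  set t := √x / √W with ht
  have ht0 : 0 ≤ t := by positivity
  have hfin (s : Finset J) : P.real {ω | Q ω ≤ q} ≤
      Real.exp (t * q - t * ∑ j ∈ s, (v j + m j ^ 2) + t ^ 2 * W) := by
    have hsub : ∀ᵐ ω ∂P, ω ∈ {ω | Q ω ≤ q} → ω ∈ {ω | ∑ j ∈ s, Y j ω ^ 2 ≤ q} := by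
      filter_upwards [hQ] with ω hω hq
      exact (sum_le_hasSum s (fun _ _ => sq_nonneg _) hω).trans hq
    refine (ENNReal.toReal_mono (measure_ne_top _ _) (measure_mono_ae hsub)).trans
      ((measureReal_sum_sq_le_le hY hind hv s ht0 q).trans ?_)
    have hsum : ∑ j ∈ s, ((v j : ℝ) ^ 2 + 2 * v j * m j ^ 2) ≤ W := by
      calc ∑ j ∈ s, ((v j : ℝ) ^ 2 + 2 * v j * m j ^ 2)
          ≤ ∑ j ∈ s, c * (v j + 2 * m j ^ 2) := by
            refine Finset.sum_le_sum fun j _ => ?_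
            have := mul_le_mul_of_nonneg_right (hvc j)
              (show 0 ≤ (v j : ℝ) + 2 * m j ^ 2 by positivity)
            linarith
        _ ≤ W := sum_le_hasSum s (fun _ _ => by positivity)
            ((hvS.add (hM.mul_left 2)).mul_left c)
    gcongr
  have hlim : Tendsto (fun s : Finset J =>
      Real.exp (t * q - t * ∑ j ∈ s, (v j + m j ^ 2) + t ^ 2 * W)) atTop
      (𝓝 (Real.exp (t * q - t * (S + M) + t ^ 2 * W))) :=
    (Real.continuous_exp.tendsto _).comp
      ((((hvS.add hM).const_mul t).const_sub (t * q)).add_const _)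
  refine (ge_of_tendsto' hlim hfin).trans (Real.exp_le_exp.2 ?_)
  have h1 : t * √W = √x := div_mul_cancel₀ _ (Real.sqrt_pos.2 hW0).ne'
  have h2 : t ^ 2 * W = x := by
    rw [← Real.sq_sqrt hW0.le, ← mul_pow, h1, Real.sq_sqrt hx]
  have h3 : t * (2 * √W * √x) = 2 * x := by
    calc t * (2 * √W * √x) = 2 * ((t * √W) * √x) := by ring
      _ = 2 * x := by rw [h1, Real.mul_self_sqrt hx]
  have h4 := mul_le_mul_of_nonneg_left hq ht0
  rw [mul_sub, h3] at h4
  linarith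

end GaussianSquares

section WhiteNoise

variable {H K J : Type*} [NormedAddCommGroup H] [InnerProductSpace ℝ H]
  [NormedAddCommGroup K] [InnerProductSpace ℝ K]
  {Ω : Type*} [MeasurableSpace Ω] {P : Measure Ω} {ξ : K → Ω → ℝ}

/-! ### White noise: linearity, isometry, independence -/

lemma IsWhiteNoise.map_zero (hξ : IsWhiteNoise ξ P) : ξ 0 =ᵐ[P] 0 := by
  simpa using hξ.smul 0 0

lemma IsWhiteNoise.map_sum_smul (hξ : IsWhiteNoise ξ P) (s : Finset J) (c : J → ℝ) (k : J → K) :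
    ξ (∑ j ∈ s, c j • k j) =ᵐ[P] fun ω => ∑ j ∈ s, c j * ξ (k j) ω := by
  classical
  induction s using Finset.induction_on with
  | empty => simpa [Pi.zero_def] using hξ.map_zero
  | insert i s hi ih =>
    simp_rw [Finset.sum_insert hi]
    filter_upwards [hξ.add (c i • k i) (∑ j ∈ s, c j • k j), hξ.smul (c i) (k i), ih]
      with ω h1 h2 h3
    rw [h1, Pi.add_apply, h2, h3, Pi.smul_apply, smul_eq_mul]

lemma IsWhiteNoise.aemeasurable (hξ : IsWhiteNoise ξ P) (k : K) : AEMeasurable (ξ k) P :=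
  (hξ.hasLaw k).aemeasurable

lemma IsWhiteNoise.lintegral_sq (hξ : IsWhiteNoise ξ P) (k : K) :
    ∫⁻ ω, ‖ξ k ω‖ₑ ^ 2 ∂P = ENNReal.ofReal (‖k‖ ^ 2) := by
  rw [(hξ.hasLaw k).lintegral_comp (f := fun x => ‖x‖ₑ ^ 2) (by fun_prop)]
  have h1 : Integrable (fun x : ℝ => x ^ 2) (gaussianReal 0 (‖k‖₊ ^ 2)) :=
    (memLp_id_gaussianReal 2).integrable_sq
  have h2 : ∫ x : ℝ, x ^ 2 ∂gaussianReal 0 (‖k‖₊ ^ 2) = ‖k‖ ^ 2 := by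
    have h := variance_fun_id_gaussianReal (μ := 0) (v := ‖k‖₊ ^ 2)
    rw [variance_eq_integral (by fun_prop)] at h
    simpa using h
  rw [← h2, ofReal_integral_eq_lintegral_ofReal h1 (ae_of_all _ fun x => sq_nonneg x)]
  refine lintegral_congr fun x => ?_
  rw [← sq_abs, ENNReal.ofReal_pow (abs_nonneg _), Real.enorm_eq_ofReal_abs]

/-- A white noise is an isometry into `L²`, hence continuous in measure. -/
lemma IsWhiteNoise.tendstoInMeasure (hξ : IsWhiteNoise ξ P) {ι : Type*} {l : Filter ι} {κ : ι → K}
    {k : K} (hκ : Tendsto κ l (𝓝 k)) : TendstoInMeasure P (fun i => ξ (κ i)) l (ξ k) := by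
  refine tendstoInMeasure_of_tendsto_eLpNorm two_ne_zero
    (fun i => (hξ.aemeasurable _).aestronglyMeasurable) (hξ.aemeasurable _).aestronglyMeasurable ?_
  have hnorm (i : ι) : eLpNorm (ξ (κ i) - ξ k) 2 P = ENNReal.ofReal ‖κ i - k‖ := by
    have hsub : ξ (κ i) - ξ k =ᵐ[P] ξ (κ i - k) := by
      filter_upwards [hξ.add (κ i - k) k] with ω h
      rw [sub_add_cancel] at h
      rw [Pi.sub_apply, h, Pi.add_apply, add_sub_cancel_right]
    rw [eLpNorm_congr_ae hsub, eLpNorm_eq_lintegral_rpow_enorm_toReal two_ne_zero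
      ENNReal.ofNat_ne_top]
    simp only [ENNReal.toReal_ofNat, ENNReal.rpow_ofNat]
    rw [hξ.lintegral_sq, ENNReal.ofReal_pow (norm_nonneg _), ← ENNReal.rpow_ofNat,
      ← ENNReal.rpow_mul]
    simp
  simp_rw [hnorm]
  have h := (tendsto_iff_norm_sub_tendsto_zero.1 hκ)
  simpa using ENNReal.tendsto_ofReal h

/-- A white noise evaluated along an orthogonal family is a family of independent variables. -/
lemma IsWhiteNoise.iIndepFun [IsProbabilityMeasure P] (hξ : IsWhiteNoise ξ P) {k : J → K}
    (hk : ∀ i j, i ≠ j → ⟪k i, k j⟫_ℝ = 0) : iIndepFun (fun j => ξ (k j)) P := by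
  rw [iIndepFun_iff_finset]
  intro s
  refine (iIndepFun_iff_charFun_pi (X := s.restrict fun j => ξ (k j))
    fun i => hξ.aemeasurable _).2 fun t => ?_
  have hnorm : ‖∑ i : s, t i • k i‖ ^ 2 = ∑ i : s, t i ^ 2 * ‖k i‖ ^ 2 := by
    rw [← real_inner_self_eq_norm_sq, sum_inner]
    refine Finset.sum_congr rfl fun i _ => ?_
    rw [inner_sum, Finset.sum_eq_single i]
    · rw [real_inner_smul_left, real_inner_smul_right, real_inner_self_eq_norm_sq]
      ring
    · intro j _ hij
      rw [real_inner_smul_left, real_inner_smul_right, hk i j fun h => hij (Subtype.ext h.symm)]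
      simp
    · simp
  -- The joint characteristic function at `t` is that of `ξ (∑ i, t i • k i)` at `1`.
  have hjoint :
      charFun (P.map fun ω => WithLp.toLp 2 fun i : s => s.restrict (fun j => ξ (k j)) i ω) t =
        charFun (P.map (ξ (∑ i : s, t i • k i))) 1 := by
    have hmeas : AEMeasurable
        (fun ω => WithLp.toLp 2 fun i : s => s.restrict (fun j => ξ (k j)) i ω) P := by
      refine (WithLp.measurable_toLp 2 _).comp_aemeasurable (aemeasurable_pi_lambda _ fun i => ?_)
      exact hξ.aemeasurable _
    rw [charFun_apply, charFun_apply, integral_map hmeas (by fun_prop),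
      integral_map (hξ.aemeasurable _) (by fun_prop)]
    refine integral_congr_ae ?_
    filter_upwards [hξ.map_sum_smul Finset.univ (fun i : s => t i) (fun i : s => k i)] with ω hω
    rw [hω]
    simp [PiLp.inner_apply]
  rw [hjoint, (hξ.hasLaw _).map_eq, charFun_gaussianReal]
  have hmarg (i : s) : charFun (P.map (s.restrict (fun j => ξ (k j)) i)) (t i) =
      Complex.exp (-(t i ^ 2 * ‖k i‖ ^ 2 : ℝ) / 2) := by
    change charFun (P.map (ξ (k i))) (t i) = _
    rw [(hξ.hasLaw _).map_eq, charFun_gaussianReal]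
    congr 1
    push_cast
    simp
    ring
  rw [Finset.prod_congr rfl fun i _ => hmarg i, ← Complex.exp_sum]
  congr 1
  rw [← Finset.sum_div, Finset.sum_neg_distrib, ← Complex.ofReal_sum, ← hnorm]
  push_cast
  simp [neg_div]

end WhiteNoise

section Observation

variable {H K : Type*} [NormedAddCommGroup H] [InnerProductSpace ℝ H]
  [NormedAddCommGroup K] [InnerProductSpace ℝ K]
  {Ω : Type*} [MeasurableSpace Ω] {P : Measure Ω} {ξ : K → Ω → ℝ}

/-! ### The observation as a weak random element -/

lemma observation_add_smul (hξ : IsWhiteNoise ξ P) (T : H →L[ℝ] K) (σ : ℝ) (f : H) {ι : Type*}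
    (s : Finset ι) (c : ι → ℝ) (k : ι → K) :
    observation T σ ξ f (∑ i ∈ s, c i • k i) =ᵐ[P]
      fun ω => ∑ i ∈ s, c i * observation T σ ξ f (k i) ω := by
  filter_upwards [hξ.map_sum_smul s c k] with ω hω
  simp only [observation, hω, inner_sum, real_inner_smul_right, Finset.mul_sum, mul_add,
    Finset.sum_add_distrib]
  congr 1
  exact Finset.sum_congr rfl fun i _ => by ring

lemma hasLaw_observation [IsProbabilityMeasure P] (hξ : IsWhiteNoise ξ P) (T : H →L[ℝ] K) (σ : ℝ)
    (f : H) (k : K) : HasLaw (observation T σ ξ f k)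
      (gaussianReal ⟪T f, k⟫_ℝ (σ.nnabs ^ 2 * ‖k‖₊ ^ 2)) P := by
  have h := gaussianReal_const_add (gaussianReal_const_mul (hξ.hasLaw k) σ) ⟪T f, k⟫_ℝ
  have hvar : σ.nnabs ^ 2 * ‖k‖₊ ^ 2 = NNReal.mk (σ ^ 2) (sq_nonneg σ) * ‖k‖₊ ^ 2 := by
    ext
    simp
  rw [mul_zero, zero_add, ← hvar] at h
  exact h

lemma aemeasurable_observation (hξ : IsWhiteNoise ξ P) (T : H →L[ℝ] K) (σ : ℝ) (f : H) (k : K) :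
    AEMeasurable (observation T σ ξ f k) P :=
  ((hξ.aemeasurable k).const_mul σ).const_add _

lemma exists_subseq_ae_tendsto_observation [IsProbabilityMeasure P] (hξ : IsWhiteNoise ξ P)
    (T : H →L[ℝ] K) (σ : ℝ) (f : H) {κ : ℕ → K} {k : K} (hκ : Tendsto κ atTop (𝓝 k)) :
    ∃ ns : ℕ → ℕ, StrictMono ns ∧ ∀ᵐ ω ∂P,
      Tendsto (fun n => observation T σ ξ f (κ (ns n)) ω) atTop (𝓝 (observation T σ ξ f k ω)) := by
  obtain ⟨ns, hns, h⟩ := (hξ.tendstoInMeasure hκ).exists_seq_tendsto_ae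
  refine ⟨ns, hns, ?_⟩
  filter_upwards [h] with ω hω
  exact (((continuous_const.inner continuous_id).tendsto k).comp
    (hκ.comp hns.tendsto_atTop)).add (hω.const_mul σ)

/-- The squared coordinates of `R Y` are almost surely summable. -/
lemma ae_summable_sq_observation [IsProbabilityMeasure P] (hξ : IsWhiteNoise ξ P) (T : H →L[ℝ] K)
    (σ : ℝ) (f : H) {ι : Type*} [Countable ι] {k : ι → K} (hk : Summable fun i => ‖k i‖ ^ 2)
    (hm : Summable fun i => ⟪T f, k i⟫_ℝ ^ 2) :
    ∀ᵐ ω ∂P, Summable fun i => observation T σ ξ f (k i) ω ^ 2 := by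
  have hint : ∫⁻ ω, ∑' i, ‖ξ (k i) ω‖ₑ ^ 2 ∂P ≠ ∞ := by
    rw [lintegral_tsum fun i => (hξ.aemeasurable (k i)).enorm.pow_const 2]
    simp_rw [hξ.lintegral_sq]
    exact hk.tsum_ofReal_ne_top
  have hae := ae_lt_top' (AEMeasurable.tsum fun i =>
    (hξ.aemeasurable (k i)).enorm.pow_const 2) hint
  filter_upwards [hae] with ω hω
  have hsum : Summable fun i => ξ (k i) ω ^ 2 := by
    refine (ENNReal.summable_toReal hω.ne).congr fun i => ?_
    simp
  refine Summable.of_nonneg_of_le (fun _ => sq_nonneg _) (fun i => ?_)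
    ((hm.mul_left 2).add ((hsum.mul_left (σ ^ 2)).mul_left 2))
  have := sq_nonneg (⟪T f, k i⟫_ℝ - σ * ξ (k i) ω)
  simp only [observation]
  nlinarith

lemma iIndepFun_observation [IsProbabilityMeasure P] (hξ : IsWhiteNoise ξ P) (T : H →L[ℝ] K)
    (σ : ℝ) (f : H) {ι : Type*} {k : ι → K} (hk : ∀ i j, i ≠ j → ⟪k i, k j⟫_ℝ = 0) :
    iIndepFun (fun i => observation T σ ξ f (k i)) P :=
  (hξ.iIndepFun hk).comp (fun i x => ⟪T f, k i⟫_ℝ + σ * x) fun _ => by fun_prop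

end Observation

section Reconstruction

variable {H K J : Type*} [NormedAddCommGroup H] [InnerProductSpace ℝ H] [CompleteSpace H]
  [NormedAddCommGroup K] [InnerProductSpace ℝ K] [CompleteSpace K]
  {Ω : Type*} [MeasurableSpace Ω] {P : Measure Ω} {ξ : K → Ω → ℝ}

/-! ### The image of an observation under a Hilbert–Schmidt operator -/

lemma hasSum_norm_sq_adjoint {R : K →L[ℝ] H} (hR : IsHilbertSchmidt R) (u : HilbertBasis J ℝ H) :
    HasSum (fun j => ‖ContinuousLinearMap.adjoint R (u j)‖ ^ 2)
      (posTrace (companion R)).toReal := by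
  have h := posTrace_companion_eq_adjoint u R
  have hsum : Summable fun j => ‖ContinuousLinearMap.adjoint R (u j)‖ ^ 2 := by
    have hne : ∑' j, ENNReal.ofReal (‖ContinuousLinearMap.adjoint R (u j)‖ ^ 2) ≠ ∞ := by
      rw [← h]
      exact hR.ne
    refine (ENNReal.summable_toReal hne).congr fun j => ?_
    rw [ENNReal.toReal_ofReal (sq_nonneg _)]
  rw [h, ← ENNReal.ofReal_tsum_of_nonneg (fun _ => sq_nonneg _) hsum,
    ENNReal.toReal_ofReal (tsum_nonneg fun _ => sq_nonneg _)]
  exact hsum.hasSum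

/-- The indices of the basis vectors that `R*` does not kill. The other coordinates of `R Y`
vanish almost surely. For a Hilbert–Schmidt operator `R` the set is countable, even if `H` is not
separable. -/
def activeIndex (R : K →L[ℝ] H) (u : HilbertBasis J ℝ H) : Set J :=
  {j | ContinuousLinearMap.adjoint R (u j) ≠ 0}

lemma countable_activeIndex {R : K →L[ℝ] H} (hR : IsHilbertSchmidt R) (u : HilbertBasis J ℝ H) :
    (activeIndex R u).Countable := by
  refine (hasSum_norm_sq_adjoint hR u).summable.countable_support.mono fun j hj => ?_
  simpa [activeIndex] using hj

lemma hasSum_activeIndex {R : K →L[ℝ] H} {u : HilbertBasis J ℝ H} {E : Type*} [AddCommMonoid E]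
    [TopologicalSpace E] {F : J → E} {a : E}
    (hF : ∀ j, ContinuousLinearMap.adjoint R (u j) = 0 → F j = 0) (h : HasSum F a) :
    HasSum (fun j : activeIndex R u => F j) a := by
  refine (hasSum_subtype_iff_of_support_subset fun j hj => ?_).2 h
  exact fun h0 => hj (hF j h0)

/-- The element `R Y` exists, and its squared norm is the sum of the squares of the coordinates
`⟪Y, R* uⱼ⟫` in any Hilbert basis `u`. -/
lemma exists_image_observation [IsProbabilityMeasure P] (hξ : IsWhiteNoise ξ P) (T : H →L[ℝ] K)
    (σ : ℝ) (f : H) {R : K →L[ℝ] H} (hR : IsHilbertSchmidt R) (u : HilbertBasis J ℝ H) :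
    ∃ X : Ω → H, StronglyMeasurable X ∧
      (∀ w : H, (fun ω => ⟪X ω, w⟫_ℝ) =ᵐ[P]
        observation T σ ξ f (ContinuousLinearMap.adjoint R w)) ∧
      ∀ᵐ ω ∂P, HasSum (fun j : activeIndex R u =>
        observation T σ ξ f (ContinuousLinearMap.adjoint R (u j)) ω ^ 2) (‖X ω‖ ^ 2) := by
  classical
  have hcount : Countable (activeIndex R u) := (countable_activeIndex hR u).to_subtype
  let k (j : J) : K := ContinuousLinearMap.adjoint R (u j)
  let y (j : activeIndex R u) (ω : Ω) : ℝ := observation T σ ξ f (k j) ω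
  have hy (j : activeIndex R u) : AEMeasurable (y j) P := aemeasurable_observation hξ T σ f _
  have hk : Summable fun j : activeIndex R u => ‖k j‖ ^ 2 :=
    (hasSum_norm_sq_adjoint hR u).summable.subtype _
  have hm : Summable fun j : activeIndex R u => ⟪T f, k j⟫_ℝ ^ 2 := by
    refine Summable.congr ((hasSum_sq_inner u (R (T f))).summable.subtype _) fun j => ?_
    simp only [Function.comp_apply, k]
    rw [ContinuousLinearMap.adjoint_inner_right, real_inner_comm]
  have hsq : ∀ᵐ ω ∂P, Summable fun j => y j ω ^ 2 := ae_summable_sq_observation hξ T σ f hk hm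
  have hu : Orthonormal ℝ fun j : activeIndex R u => u j :=
    u.orthonormal.comp _ Subtype.val_injective
  -- The sum of the coordinates converges in `H` whenever their squares are summable.
  have hsum : ∀ᵐ ω ∂P, Summable fun j => y j ω • u j := by
    filter_upwards [hsq] with ω hω
    have h := (hu.orthogonalFamily.summable_iff_norm_sq_summable fun j => y j ω).2
      (by simpa using hω)
    simpa using h
  let X₀ (ω : Ω) : H := ∑' j : activeIndex R u, y j ω • u j
  have hX₀ : AEStronglyMeasurable X₀ P := by
    refine aestronglyMeasurable_of_tendsto_ae (atTop : Filter (Finset (activeIndex R u)))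
      (f := fun s ω => ∑ j ∈ s, y j ω • u j) (fun s => ?_) ?_
    · exact Finset.aestronglyMeasurable_fun_sum s fun j _ =>
        (hy j).aestronglyMeasurable.smul_const _
    · filter_upwards [hsum] with ω hω using hω.hasSum
  have hcoord : ∀ᵐ ω ∂P, ∀ w : H, HasSum (fun j : activeIndex R u => y j ω * ⟪(u j : H), w⟫_ℝ)
      ⟪X₀ ω, w⟫_ℝ := by
    filter_upwards [hsum] with ω hω w
    have h := ((innerSL ℝ w).hasSum hω.hasSum)
    simp only [innerSL_apply_apply, inner_smul_right] at h
    rw [real_inner_comm] at h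
    refine h.congr_fun fun j => ?_
    rw [real_inner_comm]
  refine ⟨hX₀.mk X₀, hX₀.stronglyMeasurable_mk, fun w => ?_, ?_⟩
  · obtain ⟨F, hF⟩ := exists_seq_tendsto (atTop : Filter (Finset (activeIndex R u)))
    have hRw : HasSum (fun j : activeIndex R u => ⟪(u j : H), w⟫_ℝ • k j)
        (ContinuousLinearMap.adjoint R w) := by
      refine hasSum_activeIndex (F := fun j => ⟪(u j : H), w⟫_ℝ • k j)
        (fun j hj => by simp [k, hj]) ?_
      have h := (ContinuousLinearMap.adjoint R).hasSum (u.hasSum_repr w)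
      simpa [HilbertBasis.repr_apply_apply, k] using h
    obtain ⟨ns, hns, hlim⟩ := exists_subseq_ae_tendsto_observation hξ T σ f (hRw.comp hF)
    have hpart : ∀ᵐ ω ∂P, ∀ n : ℕ, observation T σ ξ f (∑ j ∈ F n, ⟪(u j : H), w⟫_ℝ • k j) ω =
        ∑ j ∈ F n, ⟪(u j : H), w⟫_ℝ * y j ω :=
      ae_all_iff.2 fun n => observation_add_smul hξ T σ f (F n) _ _
    filter_upwards [hX₀.ae_eq_mk, hcoord, hlim, hpart] with ω h1 h2 h3 h4
    rw [← h1]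
    refine tendsto_nhds_unique ((h2 w).comp (hF.comp hns.tendsto_atTop)) (h3.congr fun n => ?_)
    simp only [Function.comp_apply]
    rw [h4]
    exact Finset.sum_congr rfl fun j _ => mul_comm _ _
  · filter_upwards [hX₀.ae_eq_mk, hcoord] with ω h1 h2
    rw [← h1]
    have hin (i : J) : ⟪u i, X₀ ω⟫_ℝ = if h : i ∈ activeIndex R u then y ⟨i, h⟩ ω else 0 := by
      rw [real_inner_comm, ← (h2 (u i)).tsum_eq]
      split_ifs with h
      · rw [tsum_eq_single ⟨i, h⟩]
        · rw [real_inner_self_eq_norm_sq, u.orthonormal.1]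
          simp
        · intro j hj
          rw [u.orthonormal.2 fun h' => hj (Subtype.ext h'), mul_zero]
      · refine (tsum_congr fun j => ?_).trans tsum_zero
        rw [u.orthonormal.2 fun h' : (j : J) = i => h (h' ▸ j.2), mul_zero]
    have h := hasSum_activeIndex (R := R) (u := u) (fun j hj => ?_) (hasSum_sq_inner u (X₀ ω))
    · refine h.congr_fun fun j => ?_
      rw [hin, dif_pos j.2]
    · rw [hin, dif_neg (by simpa [activeIndex] using hj)]
      simp

/-- Strong measurability replaces the separability of `H`: it confines `X` and `X'` to a separable
set. -/
lemma ae_eq_of_forall_inner_ae_eq {X X' : Ω → H} (hX : StronglyMeasurable X)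
    (hX' : StronglyMeasurable X')
    (h : ∀ w : H, (fun ω => ⟪X ω, w⟫_ℝ) =ᵐ[P] fun ω => ⟪X' ω, w⟫_ℝ) : X =ᵐ[P] X' := by
  have hsub := hX.sub hX'
  have h0 : X - X' =ᵐ[P] 0 := by
    refine ae_eq_zero_of_forall_dual_of_isSeparable ℝ hsub.isSeparable_range (fun c => ?_)
      (ae_of_all _ fun ω => mem_range_self ω)
    filter_upwards [h ((InnerProductSpace.toDual ℝ H).symm c)] with ω hω
    have hc (x : H) : c x = ⟪x, (InnerProductSpace.toDual ℝ H).symm c⟫_ℝ := by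
      rw [real_inner_comm, InnerProductSpace.toDual_symm_apply]
    simp [hc, inner_sub_left, hω]
  filter_upwards [h0] with ω hω
  exact sub_eq_zero.1 hω

lemma ae_hasSum_norm_sq_applyTo [IsProbabilityMeasure P] (hξ : IsWhiteNoise ξ P) (T : H →L[ℝ] K)
    (σ : ℝ) (f : H) {R : K →L[ℝ] H} (hR : IsHilbertSchmidt R) (u : HilbertBasis J ℝ H) :
    ∀ᵐ ω ∂P, HasSum (fun j : activeIndex R u =>
      observation T σ ξ f (ContinuousLinearMap.adjoint R (u j)) ω ^ 2)
        (‖applyTo R (observation T σ ξ f) P ω‖ ^ 2) := by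
  obtain ⟨X, hXm, hXw, hXn⟩ := exists_image_observation hξ T σ f hR u
  have hex : ∃ X : Ω → H, StronglyMeasurable X ∧ ∀ w : H, (fun ω => ⟪X ω, w⟫_ℝ) =ᵐ[P]
      observation T σ ξ f (ContinuousLinearMap.adjoint R w) := ⟨X, hXm, hXw⟩
  have happ : applyTo R (observation T σ ξ f) P =ᵐ[P] X := by
    rw [applyTo, dif_pos hex]
    obtain ⟨h1, h2⟩ := Classical.choose_spec hex
    exact ae_eq_of_forall_inner_ae_eq h1 hXm fun w => (h2 w).trans (hXw w).symm
  filter_upwards [hXn, happ] with ω h1 h2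
  rwa [h2]

end Reconstruction

section Testing

variable {H K J : Type*} [NormedAddCommGroup H] [InnerProductSpace ℝ H] [CompleteSpace H]
  [NormedAddCommGroup K] [InnerProductSpace ℝ K] [CompleteSpace K]
  {Ω : Type*} [MeasurableSpace Ω] {P : Measure Ω} {ξ : K → Ω → ℝ}
  {T : H →L[ℝ] K} {R : K →L[ℝ] H} {u : HilbertBasis J ℝ H} {σ : ℝ}

/-! ### The errors of the test -/

/-- The variances of the coordinates of `R Y` sum up to `S²`. -/
lemma hasSum_variance (hR : IsHilbertSchmidt R) (u : HilbertBasis J ℝ H) (σ : ℝ) :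
    HasSum (fun j : activeIndex R u => ((σ.nnabs ^ 2 *
      ‖ContinuousLinearMap.adjoint R (u j)‖₊ ^ 2 : ℝ≥0) : ℝ)) (strongVar σ R) := by
  have h := hasSum_activeIndex (R := R) (u := u) (fun j hj => by simp [hj])
    (hasSum_norm_sq_adjoint hR u)
  refine (h.mul_left (σ ^ 2)).congr_fun fun j => ?_
  simp

lemma variance_ne_zero (hσ : 0 < σ) (j : activeIndex R u) :
    σ.nnabs ^ 2 * ‖ContinuousLinearMap.adjoint R (u j)‖₊ ^ 2 ≠ 0 :=
  mul_ne_zero (pow_ne_zero 2 (by simpa using hσ.ne')) (pow_ne_zero 2 (nnnorm_ne_zero_iff.2 j.2))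

lemma variance_le_weakVar (R : K →L[ℝ] H) (u : HilbertBasis J ℝ H) (σ : ℝ) (j : J) :
    ((σ.nnabs ^ 2 * ‖ContinuousLinearMap.adjoint R (u j)‖₊ ^ 2 : ℝ≥0) : ℝ) ≤ weakVar σ R := by
  have h := (ContinuousLinearMap.adjoint R).le_opNorm (u j)
  rw [u.orthonormal.1, mul_one, LinearIsometryEquiv.norm_map] at h
  simp only [NNReal.coe_mul, NNReal.coe_pow, Real.coe_nnabs, sq_abs, coe_nnnorm, weakVar]
  gcongr

/-- The threshold is bounded by means of the upper tail of `‖R Y‖²` under the null hypothesis. -/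
lemma threshold_le [IsProbabilityMeasure P] (hξ : IsWhiteNoise ξ P) (hσ : 0 < σ)
    (hR : IsHilbertSchmidt R)
    (hu : ∀ i j, i ≠ j →
      ⟪ContinuousLinearMap.adjoint R (u i), ContinuousLinearMap.adjoint R (u j)⟫_ℝ = 0)
    (hv : 0 < weakVar σ R) {α : ℝ} (hα : α ∈ Ioo (0 : ℝ) 1) :
    threshold T σ ξ P α R ≤ 2 * √(strongVar σ R) * √(weakVar σ R) * √(logLevel α) +
      2 * weakVar σ R * logLevel α := by
  have hcount : Countable (activeIndex R u) := (countable_activeIndex hR u).to_subtype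
  have htail := measureReal_tsum_sq_gt_le (P := P) (x := logLevel α)
    (Y := fun j : activeIndex R u => observation T σ ξ 0 (ContinuousLinearMap.adjoint R (u j)))
    (fun j => by simpa using hasLaw_observation hξ T σ 0 (ContinuousLinearMap.adjoint R (u j)))
    (iIndepFun_observation hξ T σ 0 fun i j hij => hu i j fun h => hij (Subtype.ext h))
    (variance_ne_zero hσ) (hv.trans_le (weakVar_le_strongVar σ hR)) hv (logLevel_nonneg hα)
    (hasSum_variance hR u σ) (fun j => variance_le_weakVar R u σ j)
    (ae_hasSum_norm_sq_applyTo hξ T σ 0 hR u)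
  rw [exp_neg_logLevel hα] at htail
  refine csInf_le ⟨-strongVar σ R, fun t ht => ?_⟩ ?_
  -- The statistic is at least `-S²`, so that the set of admissible thresholds is bounded below.
  · by_contra! hlt
    have hempty : {ω | statistic σ R P (observation T σ ξ 0) ω ≤ t} = ∅ := by
      refine eq_empty_of_forall_notMem fun ω (hω : statistic _ _ _ _ _ ≤ t) => ?_
      have := sq_nonneg ‖applyTo R (observation T σ ξ 0) P ω‖
      rw [statistic] at hω
      linarith
    have ht' : 1 - α ≤ P.real {ω | statistic σ R P (observation T σ ξ 0) ω ≤ t} := ht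
    rw [hempty, measureReal_empty] at ht'
    linarith [hα.2]
  · set t₀ := 2 * √(strongVar σ R) * √(weakVar σ R) * √(logLevel α) + 2 * weakVar σ R * logLevel α
      with ht₀
    change 1 - α ≤ P.real {ω | statistic σ R P (observation T σ ξ 0) ω ≤ t₀}
    have hcover : (univ : Set Ω) ⊆ {ω | statistic σ R P (observation T σ ξ 0) ω ≤ t₀} ∪
        {ω | strongVar σ R + 2 * √(strongVar σ R) * √(weakVar σ R) * √(logLevel α) +
          2 * weakVar σ R * logLevel α < ‖applyTo R (observation T σ ξ 0) P ω‖ ^ 2} := by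
      intro ω _
      rcases le_or_gt (statistic σ R P (observation T σ ξ 0) ω) t₀ with h | h
      · exact Or.inl h
      · refine Or.inr ?_
        change strongVar σ R + _ + _ < _
        rw [statistic] at h
        linarith
    have h1 := (measureReal_mono (μ := P) hcover).trans (measureReal_union_le _ _)
    rw [probReal_univ] at h1
    linarith

/-- Comparison of the threshold and of the fluctuation under the alternative with the squared norm
`M` of the reconstructed signal, for `p = S`, `q = v`. -/
lemma threshold_add_fluctuation_le {p q a b M : ℝ} (hp : 0 ≤ p) (hq : 0 ≤ q) (ha : 0 ≤ a)
    (hb : 0 ≤ b) (hM0 : 0 ≤ M)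
    (hM : (4 * √b + 4 * √(2 * a)) * p * q + (4 * a + 8 * b) * q ^ 2 ≤ M) :
    2 * p * q * √a + 2 * q ^ 2 * a + 2 * √(q ^ 2 * (p ^ 2 + 2 * M)) * √b ≤ M := by
  have h1 : √a ≤ √(2 * a) := Real.sqrt_le_sqrt (by linarith)
  have h2 : 2 * √(q ^ 2 * (p ^ 2 + 2 * M)) * √b ≤ 2 * p * q * √b + M / 2 + 4 * q ^ 2 * b := by
    refine le_of_sq_le_sq ?_ (by positivity)
    rw [mul_pow, mul_pow, Real.sq_sqrt (by positivity), Real.sq_sqrt hb]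
    have hbb := Real.sq_sqrt hb
    have h3 : 0 ≤ 2 * (2 * p * q * √b) * (M / 2 + 4 * q ^ 2 * b) := by positivity
    have h4 : (2 * p * q * √b) ^ 2 = 4 * p ^ 2 * q ^ 2 * b := by
      rw [mul_pow, hbb]
      ring
    have h5 := sq_nonneg (M / 2 - 4 * q ^ 2 * b)
    nlinarith
  have h6 : p * q * √a ≤ p * q * √(2 * a) := by gcongr
  linarith

/-- If the reconstructed signal exceeds the radius, the error of the second kind is at most `β`. -/
lemma measure_test_eq_zero_le [IsProbabilityMeasure P] (hξ : IsWhiteNoise ξ P) (hσ : 0 < σ)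
    (hR : IsHilbertSchmidt R)
    (hu : ∀ i j, i ≠ j →
      ⟪ContinuousLinearMap.adjoint R (u i), ContinuousLinearMap.adjoint R (u j)⟫_ℝ = 0)
    {α β : ℝ} (hα : α ∈ Ioo (0 : ℝ) 1) (hβ : β ∈ Ioo (0 : ℝ) 1) {f : H}
    (hf : radiusSq σ α β R < ‖R (T f)‖ ^ 2) :
    P {ω | test T σ ξ P α R f ω = 0} ≤ ENNReal.ofReal β := by
  have hcount : Countable (activeIndex R u) := (countable_activeIndex hR u).to_subtype
  have hM0 : 0 < ‖R (T f)‖ ^ 2 := (radiusSq_nonneg hα hβ σ R).trans_lt hf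
  have hR0 : R ≠ 0 := by
    rintro rfl
    simp at hM0
  have hv : 0 < weakVar σ R := by
    have := norm_pos_iff.2 hR0
    unfold weakVar
    positivity
  have hM : HasSum (fun j : activeIndex R u =>
      ⟪T f, ContinuousLinearMap.adjoint R (u j)⟫_ℝ ^ 2) (‖R (T f)‖ ^ 2) := by
    refine hasSum_activeIndex (F := fun j => ⟪T f, ContinuousLinearMap.adjoint R (u j)⟫_ℝ ^ 2)
      (fun j hj => by simp [hj]) ((hasSum_sq_inner u (R (T f))).congr_fun fun j => ?_)
    rw [ContinuousLinearMap.adjoint_inner_right, real_inner_comm]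
  have hthr := threshold_le (T := T) hξ hσ hR hu hv hα
  have hnum := threshold_add_fluctuation_le (Real.sqrt_nonneg (strongVar σ R))
    (Real.sqrt_nonneg (weakVar σ R)) (logLevel_nonneg hα) (logLevel_nonneg hβ) hM0.le (by
      rw [Real.sq_sqrt hv.le]
      exact hf.le)
  rw [Real.sq_sqrt hv.le, Real.sq_sqrt (strongVar_nonneg σ R)] at hnum
  have htail := measureReal_tsum_sq_le_le (P := P) (x := logLevel β)
    (q := strongVar σ R + threshold T σ ξ P α R)
    (fun j : activeIndex R u =>
      hasLaw_observation hξ T σ f (ContinuousLinearMap.adjoint R (u j)))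
    (iIndepFun_observation hξ T σ f fun i j hij => hu i j fun h => hij (Subtype.ext h))
    (variance_ne_zero hσ) hv (logLevel_nonneg hβ)
    (hasSum_variance hR u σ) (fun j => variance_le_weakVar R u σ j) hM hM0
    (ae_hasSum_norm_sq_applyTo hξ T σ f hR u) (by linarith)
  rw [exp_neg_logLevel hβ] at htail
  have hset : {ω | test T σ ξ P α R f ω = 0} = {ω | ‖applyTo R (observation T σ ξ f) P ω‖ ^ 2 ≤
      strongVar σ R + threshold T σ ξ P α R} := by
    ext ω
    change test T σ ξ P α R f ω = 0 ↔ (_ : ℝ) ≤ _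
    rw [test, statistic]
    split_ifs with h
    · exact iff_of_false (by simp) (by linarith)
    · exact iff_of_true (by simp) (by linarith)
  rw [hset, ← ofReal_measureReal]
  exact ENNReal.ofReal_le_ofReal htail

/-- The separation radius is controlled by the radius and a bound `B` of the bias. -/
lemma separationRadius_sq_le [IsProbabilityMeasure P] (hξ : IsWhiteNoise ξ P) (hσ : 0 < σ)
    (hR : IsHilbertSchmidt R)
    (hu : ∀ i j, i ≠ j →
      ⟪ContinuousLinearMap.adjoint R (u i), ContinuousLinearMap.adjoint R (u j)⟫_ℝ = 0)
    {α β : ℝ} (hα : α ∈ Ioo (0 : ℝ) 1) (hβ : β ∈ Ioo (0 : ℝ) 1) {E : Set H} {B : ℝ}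
    (hE : ∀ f ∈ E, ‖f - R (T f)‖ ≤ B) :
    separationRadius P (test T σ ξ P α R) β E ^ 2 ≤ 2 * (radiusSq σ α β R + B ^ 2) := by
  have hr := radiusSq_nonneg hα hβ σ R
  set ρ := √(2 * (radiusSq σ α β R + B ^ 2)) with hρ
  have hρ2 : ρ ^ 2 = 2 * (radiusSq σ α β R + B ^ 2) := Real.sq_sqrt (by positivity)
  have hle : separationRadius P (test T σ ξ P α R) β E ≤ ρ := by
    refine csInf_le ⟨0, fun _ h => h.1⟩ ⟨Real.sqrt_nonneg _, iSup₂_le fun f hf => ?_⟩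
    refine measure_test_eq_zero_le hξ hσ hR hu hα hβ ?_
    have h1 : ρ ^ 2 < ‖f‖ ^ 2 := pow_lt_pow_left₀ hf.2 (Real.sqrt_nonneg _) two_ne_zero
    have h2 : ‖f‖ ≤ ‖R (T f)‖ + B :=
      (norm_le_norm_add_norm_sub' f (R (T f))).trans (add_le_add_right (hE f hf.1) _)
    have h3 : ‖f‖ ^ 2 ≤ (‖R (T f)‖ + B) ^ 2 := by gcongr
    nlinarith [sq_nonneg (‖R (T f)‖ - B)]
  have h0 : 0 ≤ separationRadius P (test T σ ξ P α R) β E := Real.sInf_nonneg fun _ h => h.1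
  rw [← hρ2]
  gcongr

end Testing

end InverseTesting

theorem mainTheorem1
    {H K : Type*} [NormedAddCommGroup H] [InnerProductSpace ℝ H] [CompleteSpace H]
    [NormedAddCommGroup K] [InnerProductSpace ℝ K] [CompleteSpace K]
    {Ω : Type*} [MeasurableSpace Ω] (P : Measure Ω) [IsProbabilityMeasure P]
    (ξ : K → Ω → ℝ) (hξ : InverseTesting.IsWhiteNoise ξ P)
    (σ : ℝ) (hσ : 0 < σ)
    (T : H →L[ℝ] K) (hT : InverseTesting.IsHilbertSchmidt T)
    (α β : ℝ) (hα : α ∈ Set.Ioo (0 : ℝ) 1) (hβ : β ∈ Set.Ioo (0 : ℝ) 1)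
    (g : ℝ → ℝ → ℝ) (γ₁ γ₀ : ℝ)
    (hg : InverseTesting.IsRegularization ‖InverseTesting.companion T‖ g γ₁ γ₀)
    (φ : ℝ → ℝ) (hφ : InverseTesting.IsIndexFunction φ) (γ : ℝ)
    (hq : InverseTesting.HasQualification ‖InverseTesting.companion T‖ g φ γ)
    (τs : ℝ) (hτs : 0 < τs)
    (hτs_eq : φ τs ^ 2 = σ ^ 2 * (√(InverseTesting.effectiveDim T τs) / τs)) :
    InverseTesting.IsGrowthConstant ‖InverseTesting.companion T‖ g (max γ₀ (1 + γ₁)) ∧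
    ∀ γs : ℝ, InverseTesting.IsGrowthConstant ‖InverseTesting.companion T‖ g γs →
      (∀ f ∈ InverseTesting.sourceSet T φ,
        (⨅ τ : Set.Ioi (0 : ℝ),
            (InverseTesting.radiusSq σ α β (InverseTesting.reconstruction T g τ) +
              ‖f - InverseTesting.reconstruction T g τ (T f)‖ ^ 2)) ≤
          (InverseTesting.Cstar α β * √2 * γs ^ 2 +
            (4 * InverseTesting.logLevel α + 8 * InverseTesting.logLevel β) * γs ^ 2 /
              √(InverseTesting.effectiveDim T τs) + γ ^ 2) * φ τs ^ 2) ∧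
      InverseTesting.separationRadius P
          (InverseTesting.test T σ ξ P α (InverseTesting.reconstruction T g τs)) β
          (InverseTesting.sourceSet T φ) ^ 2 ≤
        2 * (InverseTesting.Cstar α β * √2 * γs ^ 2 +
          (4 * InverseTesting.logLevel α + 8 * InverseTesting.logLevel β) * γs ^ 2 /
            √(InverseTesting.effectiveDim T τs) + γ ^ 2) * φ τs ^ 2 := by
  open InverseTesting in
  refine ⟨isGrowthConstant_max hg, fun γs hγ => ?_⟩
  have hrad := radiusSq_le hT hγ hτs hα hβ hτs_eq
  have hbias : ∀ f ∈ sourceSet T φ, ‖f - reconstruction T g τs (T f)‖ ≤ γ * φ τs :=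
    fun f hf => norm_sub_reconstruction_le hT hγ hτs hφ hq hf
  refine ⟨fun f hf => ?_, ?_⟩
  · refine (ciInf_le ⟨0, ?_⟩ (⟨τs, hτs⟩ : Set.Ioi (0 : ℝ))).trans ?_
    · rintro _ ⟨τ, rfl⟩
      exact add_nonneg (radiusSq_nonneg hα hβ σ _) (sq_nonneg _)
    · rw [add_mul _ (γ ^ 2), ← mul_pow]
      exact add_le_add hrad (pow_le_pow_left₀ (norm_nonneg _) (hbias f hf) 2)
  · obtain ⟨J, b, ev, hb⟩ := exists_eigenbasis hT
    refine (separationRadius_sq_le hξ hσ (isHilbertSchmidt_reconstruction hT hγ hτs)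
      (fun i j hij => inner_adjoint_reconstruction_basis hb hγ hτs hij) hα hβ hbias).trans ?_
    rw [mul_assoc, add_mul _ (γ ^ 2), ← mul_pow]
    gcongr
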